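/- Let $m,s,n$ be integers with $1\le s\le m$ and $n\ge 1$. Let $\langle x,y\rangle=-\sum_{i=0}^{s}x_iy_i+\sum_{i=s+1}^{m}x_iy_i$ on $\mathbb R^{m+1}$, and let $H^m_s=\{x\in\mathbb R^{m+1}\mid\langle x,x\rangle=-1\}$ be the pseudo-hyperbolic space of dimension $m$ and index $s$, with the semi-Riemannian metric $g$ induced by $\langle\cdot,\cdot\rangle$. Let $(B,g')$ be an $n$-dimensional Riemannian manifold and let $\pi:H^m_s\to B$ be a semi-Riemannian submersion, i.e. a smooth surjective map such that $d\pi_p$ is surjective for every $p$, the fibres $\pi^{-1}(b)$ are semi-Riemannian submanifolds of $H^m_s$ (the restriction of $g$ to $\ker d\pi_p$ is nondegenerate for every $p$), and $g'(d\pi_p X,d\pi_p Y)=g(X,Y)$ for all $X,Y\in T_pH^m_s$ that are $g$-orthogonal to $\ker d\pi_p$. Assume that the fibres of $\pi$ are totally geodesic (their second fundamental form vanishes). Then $m=n+s$, the metrics induced by $g$ on the fibres are negative definite, and $B$ has negative sectional curvature, i.e. the sectional curvature of every two-dimensional subspace of every tangent space of $B$ is negative. -/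

import Mathlib

open Set Filter Topology
open scoped Manifold ContDiff

noncomputable section

/-! ## Metrics, connection and curvature in coordinates -/

section Coordinates

variable {E : Type*} [NormedAddCommGroup E] [NormedSpace ℝ E]

/-- The Christoffel symbols of the first kind of a metric `G` on an open subset of a vector space,
as the linear form
`w ↦ (1/2) (∂_u G (v, w) + ∂_v G (u, w) - ∂_w G (u, v))`. -/
def christoffelForm (G : E → E →L[ℝ] E →L[ℝ] ℝ) (y u v : E) : E →L[ℝ] ℝ :=
  (1 / 2 : ℝ) • (fderiv ℝ G y u v + fderiv ℝ G y v u - ((fderiv ℝ G y).flip u).flip v)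

theorem christoffelForm_apply (G : E → E →L[ℝ] E →L[ℝ] ℝ) (y u v w : E) :
    christoffelForm G y u v w =
      (1 / 2 : ℝ) * (fderiv ℝ G y u v w + fderiv ℝ G y v u w - fderiv ℝ G y w u v) := by
  simp [christoffelForm]

/-- The Christoffel symbols `Γ_y(u, v)` of the Levi-Civita connection of `G`: the vector with
`G_y(Γ_y(u, v), w) = christoffelForm G y u v w` for all `w` (where `G_y` is nondegenerate). -/
def christoffel (G : E → E →L[ℝ] E →L[ℝ] ℝ) (y u v : E) : E :=
  (G y).inverse (christoffelForm G y u v)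

/-- The Riemann curvature
`R(u, v) w = ∂_u Γ(v, w) - ∂_v Γ(u, w) + Γ(u, Γ(v, w)) - Γ(v, Γ(u, w))`, that is,
`R(u, v) w = ∇_u ∇_v w - ∇_v ∇_u w` for constant vector fields `u, v, w`. -/
def coordCurvature (G : E → E →L[ℝ] E →L[ℝ] ℝ) (y u v w : E) : E :=
  fderiv ℝ (fun z => christoffel G z v w) y u - fderiv ℝ (fun z => christoffel G z u w) y v
    + christoffel G y u (christoffel G y v w) - christoffel G y v (christoffel G y u w)

/-- The sectional curvature `G(R(u, v) v, u) / (G(u, u) G(v, v) - G(u, v)²)` of the plane spanned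
by `u, v`; round spheres have positive curvature. -/
def coordSectionalCurvature (G : E → E →L[ℝ] E →L[ℝ] ℝ) (y u v : E) : ℝ :=
  G y (coordCurvature G y u v v) u / (G y u u * G y v v - G y u v ^ 2)

end Coordinates

/-! ## Semi-Riemannian manifolds -/

section Manifolds

/-- A smooth semi-Riemannian metric: a smooth field of symmetric nondegenerate bilinear forms on
the tangent spaces. (On a connected manifold the index is automatically constant.) -/
structure SemiRiemannianMetric (E : Type*) [NormedAddCommGroup E] [NormedSpace ℝ E]
    (M : Type*) [TopologicalSpace M] [ChartedSpace E M] [IsManifold 𝓘(ℝ, E) ∞ M] where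
  /-- The scalar product on each tangent space. -/
  inner (x : M) : TangentSpace 𝓘(ℝ, E) x →L[ℝ] TangentSpace 𝓘(ℝ, E) x →L[ℝ] ℝ
  symm (x : M) (v w : TangentSpace 𝓘(ℝ, E) x) : inner x v w = inner x w v
  nondegenerate (x : M) (v : TangentSpace 𝓘(ℝ, E) x) (h : ∀ w, inner x v w = 0) : v = 0
  contMDiff : ContMDiff 𝓘(ℝ, E) (𝓘(ℝ, E).prod 𝓘(ℝ, E →L[ℝ] E →L[ℝ] ℝ)) ∞
    (fun x ↦ Bundle.TotalSpace.mk' (E →L[ℝ] E →L[ℝ] ℝ) x (inner x))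

variable {E : Type*} [NormedAddCommGroup E] [NormedSpace ℝ E]
  {M : Type*} [TopologicalSpace M] [ChartedSpace E M] [IsManifold 𝓘(ℝ, E) ∞ M]
  {E' : Type*} [NormedAddCommGroup E'] [NormedSpace ℝ E']
  {B : Type*} [TopologicalSpace B] [ChartedSpace E' B] [IsManifold 𝓘(ℝ, E') ∞ B]

/-- A Riemannian metric is in particular a semi-Riemannian metric. -/
def SemiRiemannianMetric.ofRiemannian
    (g : Bundle.ContMDiffRiemannianMetric 𝓘(ℝ, E) ∞ E (fun x : M => TangentSpace 𝓘(ℝ, E) x)) :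
    SemiRiemannianMetric E M where
  inner := g.inner
  symm := g.symm
  nondegenerate x v h := by
    by_contra hv
    exact (g.pos x v hv).ne' (h v)
  contMDiff := g.contMDiff

namespace SemiRiemannianMetric

/-- The metric in the preferred chart `φ` at `x`: at the point `y` of the chart domain in `E` it is
`(u, v) ↦ g(d(φ⁻¹)_y u, d(φ⁻¹)_y v)`. -/
def coord (g : SemiRiemannianMetric E M) (x : M) (y : E) : E →L[ℝ] E →L[ℝ] ℝ :=
  let D := mfderiv 𝓘(ℝ, E) 𝓘(ℝ, E) (extChartAt 𝓘(ℝ, E) x).symm y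
  (ContinuousLinearMap.precomp ℝ D) ∘L (g.inner ((extChartAt 𝓘(ℝ, E) x).symm y)) ∘L D

theorem coord_apply (g : SemiRiemannianMetric E M) (x : M) (y u v : E) :
    g.coord x y u v = g.inner ((extChartAt 𝓘(ℝ, E) x).symm y)
      (mfderiv 𝓘(ℝ, E) 𝓘(ℝ, E) (extChartAt 𝓘(ℝ, E) x).symm y u)
      (mfderiv 𝓘(ℝ, E) 𝓘(ℝ, E) (extChartAt 𝓘(ℝ, E) x).symm y v) := rfl

/-- The covariant derivative `(∇_u V)(x)` for the Levi-Civita connection of `g`, computed in the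
preferred chart `φ` at `x`: with `W` and `u'` the coordinate expressions of `V` and `u`, it is
`D W (u') + Γ(u', W)`, transported back to the tangent space at `x`. -/
def covariantDeriv (g : SemiRiemannianMetric E M) (V : Π x : M, TangentSpace 𝓘(ℝ, E) x) (x : M)
    (u : TangentSpace 𝓘(ℝ, E) x) : TangentSpace 𝓘(ℝ, E) x :=
  let φ := extChartAt 𝓘(ℝ, E) x
  let W : E → E := fun y => mfderiv 𝓘(ℝ, E) 𝓘(ℝ, E) φ (φ.symm y) (V (φ.symm y))
  let u' : E := mfderiv 𝓘(ℝ, E) 𝓘(ℝ, E) φ x u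
  (mfderiv 𝓘(ℝ, E) 𝓘(ℝ, E) φ x).inverse
    (fderiv ℝ W (φ x) u' + christoffel (g.coord x) (φ x) u' (W (φ x)))

/-- The sectional curvature of `g` at `x` on the plane spanned by the tangent vectors `u, v`,
computed in the preferred chart at `x`. -/
def sectionalCurvature (g : SemiRiemannianMetric E M) (x : M) (u v : TangentSpace 𝓘(ℝ, E) x) : ℝ :=
  coordSectionalCurvature (g.coord x) (extChartAt 𝓘(ℝ, E) x x)
    (mfderiv 𝓘(ℝ, E) 𝓘(ℝ, E) (extChartAt 𝓘(ℝ, E) x) x u)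
    (mfderiv 𝓘(ℝ, E) 𝓘(ℝ, E) (extChartAt 𝓘(ℝ, E) x) x v)

end SemiRiemannianMetric

/-! ## Semi-Riemannian submersions -/

/-- The vertical space at `p`, i.e. the tangent space at `p` of the fibre of `π` through `p`. -/
def verticalSpace (E E' : Type*) [NormedAddCommGroup E] [NormedSpace ℝ E]
    [NormedAddCommGroup E'] [NormedSpace ℝ E']
    {M : Type*} [TopologicalSpace M] [ChartedSpace E M]
    {B : Type*} [TopologicalSpace B] [ChartedSpace E' B]
    (π : M → B) (p : M) : Submodule ℝ (TangentSpace 𝓘(ℝ, E) p) :=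
  LinearMap.ker (mfderiv 𝓘(ℝ, E) 𝓘(ℝ, E') π p).toLinearMap

/-- The horizontal space at `p`: the vectors `g`-orthogonal to the fibre of `π` through `p`. -/
def IsHorizontal (g : SemiRiemannianMetric E M) (π : M → B) (p : M)
    (X : TangentSpace 𝓘(ℝ, E) p) : Prop :=
  ∀ V ∈ verticalSpace E E' π p, g.inner p X V = 0

/-- Semi-Riemannian submersions `π : (M, g) → (B, g')`. -/
structure IsSemiRiemannianSubmersion (g : SemiRiemannianMetric E M) (g' : SemiRiemannianMetric E' B)
    (π : M → B) : Prop where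
  contMDiff : ContMDiff 𝓘(ℝ, E) 𝓘(ℝ, E') ∞ π
  surjective : Function.Surjective π
  surjective_mfderiv (p : M) : Function.Surjective (mfderiv 𝓘(ℝ, E) 𝓘(ℝ, E') π p)
  /-- The fibres are semi-Riemannian submanifolds: the induced metric is nondegenerate. -/
  fibre_nondegenerate (p : M) (U : TangentSpace 𝓘(ℝ, E) p) (hU : U ∈ verticalSpace E E' π p)
    (h : ∀ V ∈ verticalSpace E E' π p, g.inner p U V = 0) : U = 0
  /-- The differential preserves scalar products of vectors normal to the fibres. -/
  inner_mfderiv (p : M) (X Y : TangentSpace 𝓘(ℝ, E) p)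
    (hX : IsHorizontal (E' := E') g π p X) (hY : IsHorizontal (E' := E') g π p Y) :
    g'.inner (π p) (mfderiv 𝓘(ℝ, E) 𝓘(ℝ, E') π p X) (mfderiv 𝓘(ℝ, E) 𝓘(ℝ, E') π p Y)
      = g.inner p X Y

/-- The fibres of `π` are totally geodesic: their second fundamental form (the normal part of
`∇_U V` for `U, V` tangent to the fibres) vanishes, i.e. `∇_U V` is vertical whenever `U` and the
local smooth vector field `V` are vertical. -/
def HasTotallyGeodesicFibres (E' : Type*) [NormedAddCommGroup E'] [NormedSpace ℝ E']
    {B : Type*} [TopologicalSpace B] [ChartedSpace E' B]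
    (g : SemiRiemannianMetric E M) (π : M → B) : Prop :=
  ∀ (p : M) (V : Π x : M, TangentSpace 𝓘(ℝ, E) x),
    ContMDiffAt 𝓘(ℝ, E) 𝓘(ℝ, E).tangent ∞ (fun x ↦ (⟨x, V x⟩ : TangentBundle 𝓘(ℝ, E) M)) p →
    (∀ᶠ x in 𝓝 p, V x ∈ verticalSpace E E' π x) →
    ∀ U ∈ verticalSpace E E' π p, g.covariantDeriv V p U ∈ verticalSpace E E' π p

end Manifolds

/-! ## Pseudo-hyperbolic spaces -/

/-- The bilinear form `⟨x, y⟩ = - ∑_{i ≤ s} x_i y_i + ∑_{i > s} x_i y_i` on `ℝ^{m+1}`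
(with coordinates `x_0, …, x_m`). -/
def pseudoForm (m s : ℕ) :
    EuclideanSpace ℝ (Fin (m + 1)) →L[ℝ] EuclideanSpace ℝ (Fin (m + 1)) →L[ℝ] ℝ :=
  ∑ i : Fin (m + 1), (if (i : ℕ) ≤ s then (-1 : ℝ) else 1) •
    (EuclideanSpace.proj (𝕜 := ℝ) i).smulRight
      (EuclideanSpace.proj i : EuclideanSpace ℝ (Fin (m + 1)) →L[ℝ] ℝ)

/-- The pseudo-hyperbolic space `H^m_s = {x ∈ ℝ^{m+1} | ⟨x, x⟩ = -1}`, with the subspace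
topology. -/
def PseudoHyperbolicSpace (m s : ℕ) : Type :=
  {x : EuclideanSpace ℝ (Fin (m + 1)) // pseudoForm m s x x = -1}

namespace PseudoHyperbolicSpace

variable {m s : ℕ}


instance : TopologicalSpace (PseudoHyperbolicSpace m s) :=
  inferInstanceAs (TopologicalSpace {x : EuclideanSpace ℝ (Fin (m + 1)) // pseudoForm m s x x = -1})

/-- The inclusion of `H^m_s` in `ℝ^{m+1}`. -/
def incl (x : PseudoHyperbolicSpace m s) : EuclideanSpace ℝ (Fin (m + 1)) := x.1

/-- The point of `H^m_s` given by a vector `x` with `⟨x, x⟩ = -1`. -/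
def mk (x : EuclideanSpace ℝ (Fin (m + 1))) (hx : pseudoForm m s x x = -1) :
    PseudoHyperbolicSpace m s := ⟨x, hx⟩

theorem incl_mk (x : EuclideanSpace ℝ (Fin (m + 1))) (hx : pseudoForm m s x x = -1) :
    (mk x hx).incl = x := rfl

theorem continuous_incl : Continuous (incl : PseudoHyperbolicSpace m s → EuclideanSpace ℝ (Fin (m + 1))) :=
  continuous_subtype_val

theorem pseudoForm_incl (x : PseudoHyperbolicSpace m s) :
    pseudoForm m s x.incl x.incl = -1 := x.2

theorem pseudoForm_apply (x y : EuclideanSpace ℝ (Fin (m + 1))) : pseudoForm m s x y =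
    ∑ i : Fin (m + 1), (if (i : ℕ) ≤ s then (-1 : ℝ) else 1) * (x i * y i) := by
  rw [pseudoForm, sum_apply, sum_apply]
  refine Finset.sum_congr rfl fun i _ => ?_
  split_ifs <;> simp

theorem pseudoForm_symm (x y : EuclideanSpace ℝ (Fin (m + 1))) : pseudoForm m s x y = pseudoForm m s y x := by
  simp only [pseudoForm_apply, mul_comm]

theorem pseudoForm_nondegenerate (x : EuclideanSpace ℝ (Fin (m + 1))) (h : ∀ y, pseudoForm m s x y = 0) : x = 0 := by
  ext i
  have := h (EuclideanSpace.single i 1)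
  simp only [pseudoForm_apply, PiLp.single_apply, mul_ite, mul_one, mul_zero,
    Finset.sum_ite_eq', Finset.mem_univ, if_true] at this
  split_ifs at this <;> simpa using this

/-- The tangent space of `H^m_s` at `p` as a linear subspace of `ℝ^{m+1}`: the orthogonal
complement of `p` for the form `⟨·, ·⟩`. -/
def perp (p : PseudoHyperbolicSpace m s) : Submodule ℝ (EuclideanSpace ℝ (Fin (m + 1))) :=
  LinearMap.ker (pseudoForm m s p.incl).toLinearMap

theorem finrank_perp (p : PseudoHyperbolicSpace m s) : Module.finrank ℝ p.perp = m := by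
  have hne : (pseudoForm m s p.incl).toLinearMap ≠ 0 := by
    intro h
    have h1 := p.pseudoForm_incl
    have : pseudoForm m s p.incl p.incl = 0 := congrArg (fun f => f p.incl) h
    linarith
  have hr : LinearMap.range (pseudoForm m s p.incl).toLinearMap = ⊤ :=
    LinearMap.range_eq_top.2 (LinearMap.surjective hne)
  have := LinearMap.finrank_range_add_finrank_ker (pseudoForm m s p.incl).toLinearMap
  rw [hr] at this
  simp only [finrank_top, Module.finrank_self, finrank_euclideanSpace, Fintype.card_fin] at this
  change Module.finrank ℝ (LinearMap.ker (pseudoForm m s p.incl).toLinearMap) = m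
  omega

/-- A linear isomorphism between the tangent space at `p` and `ℝ^m`. -/
def perpEquiv (p : PseudoHyperbolicSpace m s) : p.perp ≃L[ℝ] (EuclideanSpace ℝ (Fin m)) :=
  ContinuousLinearEquiv.ofFinrankEq (by rw [finrank_perp]; simp)

/-- The projection `x ↦ x + ⟨p, x⟩ p` of `ℝ^{m+1}` onto the tangent space at `p`, along `p`. -/
def proj (p : PseudoHyperbolicSpace m s) : EuclideanSpace ℝ (Fin (m + 1)) →L[ℝ] p.perp :=
  (ContinuousLinearMap.id ℝ (EuclideanSpace ℝ (Fin (m + 1))) + (pseudoForm m s p.incl).smulRight p.incl).codRestrict p.perp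
    (fun x => by
      simp [perp, p.pseudoForm_incl])

theorem coe_proj (p : PseudoHyperbolicSpace m s) (x : EuclideanSpace ℝ (Fin (m + 1))) :
    (p.proj x : EuclideanSpace ℝ (Fin (m + 1))) = x + pseudoForm m s p.incl x • p.incl := rfl

/-- The inclusion of `ℝ^m`, identified with the tangent space at `p`, in `ℝ^{m+1}`. -/
def emb (p : PseudoHyperbolicSpace m s) : EuclideanSpace ℝ (Fin m) →L[ℝ] EuclideanSpace ℝ (Fin (m + 1)) :=
  p.perp.subtypeL ∘L (p.perpEquiv.symm : EuclideanSpace ℝ (Fin m) →L[ℝ] p.perp)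

theorem pseudoForm_emb (p : PseudoHyperbolicSpace m s) (w : EuclideanSpace ℝ (Fin m)) :
    pseudoForm m s p.incl (p.emb w) = 0 := (p.perpEquiv.symm w).2

/-- The graph parametrization `w ↦ w + √(1 + ⟨w, w⟩) p` of `H^m_s` around `p`. -/
def graph (p : PseudoHyperbolicSpace m s) (w : EuclideanSpace ℝ (Fin m)) : EuclideanSpace ℝ (Fin (m + 1)) :=
  p.emb w + √(1 + pseudoForm m s (p.emb w) (p.emb w)) • p.incl

theorem pseudoForm_graph (p : PseudoHyperbolicSpace m s) {w : EuclideanSpace ℝ (Fin m)}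
    (hw : 0 < 1 + pseudoForm m s (p.emb w) (p.emb w)) :
    pseudoForm m s (p.graph w) (p.graph w) = -1 := by
  have h1 := p.pseudoForm_emb w
  have h2 := p.pseudoForm_incl
  have h3 := pseudoForm_symm (s := s) p.incl (p.emb w)
  have h4 := Real.mul_self_sqrt hw.le
  simp only [graph, map_add, map_smul, add_apply, smul_apply, smul_eq_mul,
    ← h3, h1, h2]
  linear_combination -h4

theorem pseudoForm_incl_graph (p : PseudoHyperbolicSpace m s) (w : EuclideanSpace ℝ (Fin m)) :
    pseudoForm m s p.incl (p.graph w) = -√(1 + pseudoForm m s (p.emb w) (p.emb w)) := by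
  simp [graph, p.pseudoForm_emb, p.pseudoForm_incl]

theorem isOpen_chartTarget (p : PseudoHyperbolicSpace m s) :
    IsOpen {w : EuclideanSpace ℝ (Fin m) | 0 < 1 + pseudoForm m s (p.emb w) (p.emb w)} :=
  isOpen_lt continuous_const (by fun_prop)

theorem contDiffOn_graph (p : PseudoHyperbolicSpace m s) :
    ContDiffOn ℝ ∞ p.graph {w : EuclideanSpace ℝ (Fin m) | 0 < 1 + pseudoForm m s (p.emb w) (p.emb w)} := by
  unfold graph
  refine p.emb.contDiff.contDiffOn.add (ContDiffOn.fun_smul ?_ contDiffOn_const)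
  refine ContDiffOn.sqrt ?_ (fun w hw => ne_of_gt hw)
  have h : ContDiff ℝ ∞ (fun w : EuclideanSpace ℝ (Fin m) => (pseudoForm m s (p.emb w)) (p.emb w)) :=
    ((pseudoForm m s).contDiff.comp p.emb.contDiff).clm_apply p.emb.contDiff
  exact (contDiff_const.add h).contDiffOn

open Classical in
/-- The chart of `H^m_s` around `p`: the orthogonal projection, along `p`, onto the tangent space
at `p`, restricted to the open set `⟨p, x⟩ < 0`. -/
def chart (p : PseudoHyperbolicSpace m s) :
    OpenPartialHomeomorph (PseudoHyperbolicSpace m s) (EuclideanSpace ℝ (Fin m)) where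
  toFun x := p.perpEquiv (p.proj x.incl)
  invFun w := if hw : 0 < 1 + pseudoForm m s (p.emb w) (p.emb w) then
    mk (p.graph w) (p.pseudoForm_graph hw) else p
  source := {x | pseudoForm m s p.incl x.incl < 0}
  target := {w | 0 < 1 + pseudoForm m s (p.emb w) (p.emb w)}
  map_source' x hx := by
    have hx' : pseudoForm m s p.incl x.incl < 0 := hx
    have e : p.emb (p.perpEquiv (p.proj x.incl)) = x.incl + pseudoForm m s p.incl x.incl • p.incl := by
      simp [emb, coe_proj]
    simp only [mem_ofPred_eq, e, map_add, map_smul, add_apply,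
      smul_apply, smul_eq_mul, x.pseudoForm_incl, p.pseudoForm_incl,
      pseudoForm_symm x.incl p.incl]
    nlinarith [mul_pos_of_neg_of_neg hx' hx']
  map_target' w hw := by
    have hw' : 0 < 1 + pseudoForm m s (p.emb w) (p.emb w) := hw
    have : pseudoForm m s p.incl (p.graph w) < 0 := by
      rw [p.pseudoForm_incl_graph]
      exact neg_lt_zero.2 (Real.sqrt_pos.2 hw')
    change pseudoForm m s p.incl (incl (dite _ _ _)) < 0
    rw [dif_pos hw', incl_mk]
    exact this
  left_inv' x hx := by
    have hx' : pseudoForm m s p.incl x.incl < 0 := hx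
    have e : p.emb (p.perpEquiv (p.proj x.incl)) = x.incl + pseudoForm m s p.incl x.incl • p.incl := by
      simp [emb, coe_proj]
    have e2 : 1 + pseudoForm m s (p.emb (p.perpEquiv (p.proj x.incl)))
        (p.emb (p.perpEquiv (p.proj x.incl))) = (pseudoForm m s p.incl x.incl) ^ 2 := by
      simp only [e, map_add, map_smul, add_apply,
        smul_apply, smul_eq_mul, x.pseudoForm_incl, p.pseudoForm_incl,
        pseudoForm_symm x.incl p.incl]
      ring
    have h0 : 0 < 1 + pseudoForm m s (p.emb (p.perpEquiv (p.proj x.incl)))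
        (p.emb (p.perpEquiv (p.proj x.incl))) := by
      rw [e2]; exact sq_pos_of_neg hx'
    rw [dif_pos h0]
    apply Subtype.ext
    change p.graph _ = x.incl
    rw [graph, e2, e, Real.sqrt_sq_eq_abs, abs_of_neg hx']
    module
  right_inv' w hw := by
    have hw' : 0 < 1 + pseudoForm m s (p.emb w) (p.emb w) := hw
    rw [dif_pos hw']
    change p.perpEquiv (p.proj (p.graph w)) = w
    rw [← ContinuousLinearEquiv.eq_symm_apply]
    apply Subtype.ext
    rw [coe_proj, p.pseudoForm_incl_graph, graph]
    change _ = p.emb w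
    module
  open_source := isOpen_lt ((pseudoForm m s p.incl).continuous.comp continuous_incl)
    continuous_const
  open_target := p.isOpen_chartTarget
  continuousOn_toFun :=
    (p.perpEquiv.continuous.comp (p.proj.continuous.comp continuous_incl)).continuousOn
  continuousOn_invFun := by
    rw [continuousOn_iff_continuous_domRestrict]
    refine Continuous.subtype_mk (f := 
      fun w : {w : EuclideanSpace ℝ (Fin m) | 0 < 1 + pseudoForm m s (p.emb w) (p.emb w)} =>
        p.graph w) ?_ (fun w => p.pseudoForm_graph w.2) |>.congr ?_
    · exact continuousOn_iff_continuous_domRestrict.1 p.contDiffOn_graph.continuousOn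
    · rintro ⟨w, hw⟩
      have hw' : 0 < 1 + pseudoForm m s (p.emb w) (p.emb w) := hw
      simp only [domRestrict_apply, dif_pos hw']
      rfl

theorem incl_chart_symm (p : PseudoHyperbolicSpace m s) {w : EuclideanSpace ℝ (Fin m)} (hw : w ∈ p.chart.target) :
    (p.chart.symm w).incl = p.graph w := by
  have hw' : 0 < 1 + pseudoForm m s (p.emb w) (p.emb w) := hw
  change incl (dite _ _ _) = _
  rw [dif_pos hw']
  rfl

instance : ChartedSpace (EuclideanSpace ℝ (Fin m)) (PseudoHyperbolicSpace m s) where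
  atlas := range chart
  chartAt := chart
  mem_chart_source p := by
    change pseudoForm m s p.incl p.incl < 0
    rw [p.pseudoForm_incl]; norm_num
  chart_mem_atlas p := mem_range_self p

instance : IsManifold 𝓘(ℝ, EuclideanSpace ℝ (Fin m)) ∞ (PseudoHyperbolicSpace m s) := by
  apply isManifold_of_contDiffOn
  rintro _ _ ⟨p, rfl⟩ ⟨q, rfl⟩
  have h : ContDiffOn ℝ ∞ (fun w => q.perpEquiv (q.proj (p.graph w))) p.chart.target :=
    q.perpEquiv.contDiff.comp_contDiffOn (q.proj.contDiff.comp_contDiffOn p.contDiffOn_graph)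
  have hsub : (𝓘(ℝ, EuclideanSpace ℝ (Fin m)).symm ⁻¹' (p.chart.symm ≫ₕ q.chart).source ∩ range 𝓘(ℝ, EuclideanSpace ℝ (Fin m)))
      ⊆ p.chart.target := by
    intro w hw
    exact hw.1.1
  refine (h.mono hsub).congr (fun w hw => ?_)
  change q.perpEquiv (q.proj (p.chart.symm w).incl) = _
  rw [p.incl_chart_symm (hsub hw)]

theorem contMDiff_incl : ContMDiff 𝓘(ℝ, EuclideanSpace ℝ (Fin m)) 𝓘(ℝ, EuclideanSpace ℝ (Fin (m + 1))) ∞ (incl : PseudoHyperbolicSpace m s → EuclideanSpace ℝ (Fin (m + 1))) := by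
  intro p
  rw [contMDiffAt_iff]
  refine ⟨continuous_incl.continuousAt, ?_⟩
  have hmem : p.chart p ∈ p.chart.target :=
    p.chart.map_source (mem_chart_source (EuclideanSpace ℝ (Fin m)) p)
  have h : ContDiffAt ℝ ∞ p.graph (p.chart p) :=
    p.contDiffOn_graph.contDiffAt (p.isOpen_chartTarget.mem_nhds hmem)
  refine ContDiffAt.contDiffWithinAt (h.congr_of_eventuallyEq ?_)
  filter_upwards [p.chart.open_target.mem_nhds hmem] with w hw
  exact p.incl_chart_symm hw

/-- The differential of the inclusion of `H^m_s` in `ℝ^{m+1}`. -/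
def dIncl (p : PseudoHyperbolicSpace m s) : TangentSpace 𝓘(ℝ, EuclideanSpace ℝ (Fin m)) p →L[ℝ] EuclideanSpace ℝ (Fin (m + 1)) :=
  mfderiv 𝓘(ℝ, EuclideanSpace ℝ (Fin m)) 𝓘(ℝ, EuclideanSpace ℝ (Fin (m + 1))) incl p

theorem chart_self (p : PseudoHyperbolicSpace m s) : p.chart p = 0 := by
  change p.perpEquiv (p.proj p.incl) = 0
  have : p.proj p.incl = 0 := by
    apply Subtype.ext
    rw [coe_proj, p.pseudoForm_incl]
    simp
  rw [this, map_zero]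

theorem dIncl_eq (p : PseudoHyperbolicSpace m s) : p.dIncl = p.emb := by
  have hmem : p.chart p ∈ p.chart.target := p.chart.map_source (mem_chart_source (EuclideanSpace ℝ (Fin m)) p)
  have hg : HasFDerivAt p.graph p.emb 0 := by
    have hQ : HasFDerivAt (fun w : EuclideanSpace ℝ (Fin m) => 1 + pseudoForm m s (p.emb w) (p.emb w))
        (0 : EuclideanSpace ℝ (Fin m) →L[ℝ] ℝ) 0 := by
      have h1 : HasFDerivAt (fun w : EuclideanSpace ℝ (Fin m) => pseudoForm m s (p.emb w))
        ((pseudoForm m s) ∘L p.emb) 0 := ((pseudoForm m s) ∘L p.emb).hasFDerivAt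
      have h2 := (h1.clm_apply p.emb.hasFDerivAt).const_add 1
      refine h2.congr_fderiv ?_
      ext w
      simp
    have hs := (hQ.sqrt (by simp)).smul_const p.incl
    have := p.emb.hasFDerivAt.add hs
    refine this.congr_fderiv ?_
    ext w
    simp
  have hm : MDifferentiableAt 𝓘(ℝ, EuclideanSpace ℝ (Fin m)) 𝓘(ℝ, EuclideanSpace ℝ (Fin (m + 1))) (incl : PseudoHyperbolicSpace m s → EuclideanSpace ℝ (Fin (m + 1))) p :=
    (contMDiff_incl p).mdifferentiableAt (by simp)
  have hd : p.dIncl = fderivWithin ℝ (writtenInExtChartAt 𝓘(ℝ, EuclideanSpace ℝ (Fin m))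
      𝓘(ℝ, EuclideanSpace ℝ (Fin (m + 1))) p (incl : PseudoHyperbolicSpace m s → _))
      (range 𝓘(ℝ, EuclideanSpace ℝ (Fin m))) (extChartAt 𝓘(ℝ, EuclideanSpace ℝ (Fin m)) p p) :=
    if_pos hm
  rw [hd]
  simp only [modelWithCornersSelf_coe, range_id, fderivWithin_univ]
  have he : writtenInExtChartAt 𝓘(ℝ, EuclideanSpace ℝ (Fin m)) 𝓘(ℝ, EuclideanSpace ℝ (Fin (m + 1))) p (incl : PseudoHyperbolicSpace m s → EuclideanSpace ℝ (Fin (m + 1)))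
      =ᶠ[𝓝 (p.chart p)] p.graph := by
    filter_upwards [p.chart.open_target.mem_nhds hmem] with w hw
    exact p.incl_chart_symm hw
  have h2 : (extChartAt 𝓘(ℝ, EuclideanSpace ℝ (Fin m)) p) p = p.chart p := rfl
  rw [h2, he.fderiv_eq, chart_self]
  exact hg.fderiv

/-- The scalar product `(u, v) ↦ ⟨dι u, dι v⟩` induced on the tangent spaces of `H^m_s` by the form
`⟨·, ·⟩`, where `ι` is the inclusion in `ℝ^{m+1}`. -/
def metricInner (p : PseudoHyperbolicSpace m s) :
    TangentSpace 𝓘(ℝ, EuclideanSpace ℝ (Fin m)) p →L[ℝ]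
      TangentSpace 𝓘(ℝ, EuclideanSpace ℝ (Fin m)) p →L[ℝ] ℝ :=
  (ContinuousLinearMap.precomp ℝ p.dIncl) ∘L (pseudoForm m s) ∘L p.dIncl

theorem metricInner_apply (p : PseudoHyperbolicSpace m s)
    (u v : TangentSpace 𝓘(ℝ, EuclideanSpace ℝ (Fin m)) p) :
    p.metricInner u v = pseudoForm m s (p.dIncl u) (p.dIncl v) := rfl

theorem dIncl_apply (p : PseudoHyperbolicSpace m s) (v : EuclideanSpace ℝ (Fin m)) :
    p.dIncl v = p.emb v := by
  have := p.dIncl_eq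
  exact congrArg (fun L : EuclideanSpace ℝ (Fin m) →L[ℝ] EuclideanSpace ℝ (Fin (m + 1)) => L v) this

theorem emb_nondegenerate (p : PseudoHyperbolicSpace m s) (v : EuclideanSpace ℝ (Fin m))
    (h : ∀ w, pseudoForm m s (p.emb v) (p.emb w) = 0) : v = 0 := by
  have h0 : p.emb v = 0 := by
    apply pseudoForm_nondegenerate (s := s)
    intro y
    have hy : y = p.emb (p.perpEquiv (p.proj y)) - pseudoForm m s p.incl y • p.incl := by
      simp [emb, coe_proj]
    rw [hy, map_sub, h, map_smul, pseudoForm_symm _ p.incl, p.pseudoForm_emb]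
    simp
  have h1 : p.perpEquiv.symm v = 0 := Subtype.ext h0
  exact (map_eq_zero_iff p.perpEquiv.symm p.perpEquiv.symm.injective).1 h1

theorem contMDiff_metricInner :
    ContMDiff 𝓘(ℝ, EuclideanSpace ℝ (Fin m)) (𝓘(ℝ, EuclideanSpace ℝ (Fin m)).prod
      𝓘(ℝ, EuclideanSpace ℝ (Fin m) →L[ℝ] EuclideanSpace ℝ (Fin m) →L[ℝ] ℝ)) ∞
    (fun p : PseudoHyperbolicSpace m s ↦ Bundle.TotalSpace.mk'
      (EuclideanSpace ℝ (Fin m) →L[ℝ] EuclideanSpace ℝ (Fin m) →L[ℝ] ℝ)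
      (E := fun p : PseudoHyperbolicSpace m s =>
        TangentSpace 𝓘(ℝ, EuclideanSpace ℝ (Fin m)) p →L[ℝ]
          TangentSpace 𝓘(ℝ, EuclideanSpace ℝ (Fin m)) p →L[ℝ] ℝ) p p.metricInner) := by
  intro p
  rw [contMDiffAt_hom_bundle]
  refine ⟨contMDiffAt_id, ?_⟩
  have hD := (contMDiff_incl (m := m) (s := s) p).mfderiv_const (m := ∞) (by simp)
  set D := inTangentCoordinates 𝓘(ℝ, EuclideanSpace ℝ (Fin m))
    𝓘(ℝ, EuclideanSpace ℝ (Fin (m + 1))) id (incl : PseudoHyperbolicSpace m s → _)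
    (mfderiv 𝓘(ℝ, EuclideanSpace ℝ (Fin m)) 𝓘(ℝ, EuclideanSpace ℝ (Fin (m + 1))) incl) p with hDdef
  have hB : ContDiff ℝ ∞ (fun L : EuclideanSpace ℝ (Fin m) →L[ℝ] EuclideanSpace ℝ (Fin (m + 1)) =>
      (pseudoForm m s).bilinearComp L L) := by
    refine contDiff_clm_apply_iff.2 fun v => contDiff_clm_apply_iff.2 fun w => ?_
    simp only [ContinuousLinearMap.bilinearComp_apply]
    exact ((pseudoForm m s).contDiff.comp (contDiff_id.clm_apply contDiff_const)).clm_apply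
      (contDiff_id.clm_apply contDiff_const)
  refine (hB.contDiffAt.contMDiffAt.comp p hD).congr_of_eventuallyEq ?_
  filter_upwards [(chart_source_mem_nhds (EuclideanSpace ℝ (Fin m)) p)] with x hx
  ext v w
  have hDx : ∀ v, D x v = x.dIncl
      ((trivializationAt (EuclideanSpace ℝ (Fin m))
        (TangentSpace 𝓘(ℝ, EuclideanSpace ℝ (Fin m))) p).symm x v) := by
    intro v
    simp only [hDdef, inTangentCoordinates, ContinuousLinearMap.inCoordinates,
      TangentBundle.continuousLinearMapAt_model_space]
    change x.dIncl ((trivializationAt (EuclideanSpace ℝ (Fin m))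
      (TangentSpace 𝓘(ℝ, EuclideanSpace ℝ (Fin m))) p).symmL ℝ x v) = _
    rw [Bundle.Trivialization.symmL_apply _ hx]
  rw [inCoordinates_apply_eq₂ hx hx (mem_univ _)]
  simp [hDx, metricInner_apply]

/-- The semi-Riemannian metric of `H^m_s` induced from the form `⟨·, ·⟩` on `ℝ^{m+1}`. -/
def metric (m s : ℕ) :
    SemiRiemannianMetric (EuclideanSpace ℝ (Fin m)) (PseudoHyperbolicSpace m s) where
  inner p := p.metricInner
  symm p v w := pseudoForm_symm _ _
  nondegenerate p v h := by
    apply p.emb_nondegenerate v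
    intro w
    exact (congrArg₂ (fun a b => pseudoForm m s a b) (p.dIncl_apply v)
      (p.dIncl_apply w)).symm.trans (h w)
  contMDiff := contMDiff_metricInner

end PseudoHyperbolicSpace

end

/-! The geometry of the submersion is computed in the flat space `ℝ^{m+1}`. Let `q = pseudoForm m
s`. Composing `π` with the radial projection of the cone `q(x, x) < 0` onto the quadric, and with a
chart of the base, gives a map `f` of degree zero between open sets of vector spaces. Write `G` for
the base metric in the chart. `IsConicSubmersion` records what is needed: `df_x x = 0`; a horizontal
lift `L_x` with `df_x ∘ L_x = id` and `q(L_x u, a) = -q(x, x) G(u, df_x a)`; and `D²f(V, W) = 0` for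
vertical `V, W`, i.e. `df V = df W = 0`. The last condition is total geodesy of the fibres
(`hessian_coneMap`). Everything else follows by differentiating these identities.

Vertical directions. For vertical `V` put `A_V u = D²f(V, L u)`. Differentiating the lift identity
shows that `A_V` is skew for `G`, up to a multiple of `q(x, V)`. Differentiating once more along `V`
gives, on the quadric and for `V` orthogonal to `x`, `q(V, V) G(u, u) = -G(A_V u, A_V u)`
(`form_vertical`). This is the O'Neill equation for a plane spanned by a horizontal and a vertical
vector in a space of curvature `-1`. Since `G` is positive definite and `n ≥ 1`, `q` is nonpositive
on the fibres; being nondegenerate there, it is negative definite (`form_emb_neg`).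

Dimension. `ker df` consists of the vertical tangent vectors and the radial line, so it is negative
definite of dimension `m + 1 - n ≤ s + 1`. The horizontal space is positive definite, so `n ≤ m -
s`. Hence `m = n + s` (`finrank_add_eq`).

Curvature. Pulling `G` back by `z ↦ f(x + L_x z)` gives a metric whose first derivatives vanish at
`0` and whose second derivatives are explicit. This yields O'Neill's formula `G(R(u, v) v, u) =
-(G(u, u) G(v, v) - G(u, v)²) + 3 q(I, I)` (`curvature_formula`), where `I = integrability f G L x u
v` is vertical and orthogonal to `x`. By the vertical part `q(I, I) ≤ 0`, so the curvature is
negative. -/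

noncomputable section

/-! ## Derivatives of smooth maps -/

section Derivatives

variable {E F : Type*} [NormedAddCommGroup E] [NormedSpace ℝ E]
  [NormedAddCommGroup F] [NormedSpace ℝ F]

theorem ContDiffAt.contDiffAt_fderiv_infty {f : E → F} {x : E} (h : ContDiffAt ℝ ∞ f x) :
    ContDiffAt ℝ ∞ (fderiv ℝ f) x :=
  h.fderiv_right (m := ∞) (by simp)

theorem ContDiffAt.hasFDerivAt_infty {f : E → F} {x : E} (h : ContDiffAt ℝ ∞ f x) :
    HasFDerivAt f (fderiv ℝ f x) x :=
  (h.differentiableAt (by simp)).hasFDerivAt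

theorem ContDiffAt.fderiv_fderiv_comm {f : E → F} {x : E} (h : ContDiffAt ℝ ∞ f x) (a b : E) :
    fderiv ℝ (fderiv ℝ f) x a b = fderiv ℝ (fderiv ℝ f) x b a :=
  (h.isSymmSndFDerivAt (n := ∞) (by
    rw [minSmoothness_of_isRCLikeNormedField]; exact ENat.LEInfty.out)).eq a b

/-- The device behind most computations below: an identity valid near a point is differentiated by
finding the derivative of each side with the product rule and comparing them in a direction `c`. -/
theorem HasFDerivAt.unique_of_eventuallyEq {f g : E → F} {f' g' : E →L[ℝ] F} {x : E}
    (hf : HasFDerivAt f f' x) (hg : HasFDerivAt g g' x) (h : f =ᶠ[𝓝 x] g) (c : E) :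
    f' c = g' c := by
  rw [hf.unique (hg.congr_of_eventuallyEq h)]

end Derivatives

/-! ## Change of coordinates for the curvature -/

section CoordinateChange

set_option maxSynthPendingDepth 3

variable {F : Type*} [NormedAddCommGroup F] [NormedSpace ℝ F]

/-- The Christoffel symbols of the first kind, as a continuous trilinear form. -/
def christoffelFormCLM (G : F → F →L[ℝ] F →L[ℝ] ℝ) (y : F) : F →L[ℝ] F →L[ℝ] F →L[ℝ] ℝ :=
  (1 / 2 : ℝ) • (fderiv ℝ G y + (fderiv ℝ G y).flip -
    (ContinuousLinearMap.flipₗᵢ ℝ F F ℝ : (F →L[ℝ] F →L[ℝ] ℝ) →L[ℝ] F →L[ℝ] F →L[ℝ] ℝ) ∘L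
      (fderiv ℝ G y).flip)

/-- The Christoffel symbols, as a continuous bilinear map. -/
def christoffelCLM (G : F → F →L[ℝ] F →L[ℝ] ℝ) (y : F) : F →L[ℝ] F →L[ℝ] F :=
  ContinuousLinearMap.compL ℝ F (F →L[ℝ] ℝ) F (G y).inverse ∘L christoffelFormCLM G y

theorem christoffelCLM_apply (G : F → F →L[ℝ] F →L[ℝ] ℝ) (y u v : F) :
    christoffelCLM G y u v = christoffel G y u v := rfl

theorem contDiffAt_christoffelFormCLM {G : F → F →L[ℝ] F →L[ℝ] ℝ} {y : F}
    (hG : ContDiffAt ℝ ∞ G y) : ContDiffAt ℝ ∞ (christoffelFormCLM G) y := by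
  have h1 := hG.contDiffAt_fderiv_infty
  have h2 : ContDiffAt ℝ ∞ (fun z => (fderiv ℝ G z).flip) y :=
    (ContinuousLinearMap.flipₗᵢ ℝ F F (F →L[ℝ] ℝ)).contDiff.contDiffAt.comp y h1
  exact ((h1.add h2).sub (contDiffAt_const.clm_comp h2)).const_smul (1 / 2 : ℝ)

theorem contDiffAt_christoffelCLM [CompleteSpace F] {G : F → F →L[ℝ] F →L[ℝ] ℝ} {y : F}
    (hG : ContDiffAt ℝ ∞ G y) (hy : (G y).IsInvertible) :
    ContDiffAt ℝ ∞ (christoffelCLM G) y := by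
  have h1 : ContDiffAt ℝ ∞ (fun z => (G z).inverse) y := hy.contDiffAt_map_inverse.comp y hG
  exact ((ContinuousLinearMap.compL ℝ F (F →L[ℝ] ℝ) F).contDiff.contDiffAt.comp y h1).clm_comp
    (contDiffAt_christoffelFormCLM hG)

theorem apply_christoffel {G : F → F →L[ℝ] F →L[ℝ] ℝ} {y : F} (hy : (G y).IsInvertible)
    (u v w : F) : G y (christoffel G y u v) w = christoffelForm G y u v w := by
  obtain ⟨e, he⟩ := hy
  rw [christoffel, ← he, ContinuousLinearMap.inverse_equiv]
  simp

theorem coordCurvature_eq {G : F → F →L[ℝ] F →L[ℝ] ℝ} {y : F}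
    (hG : DifferentiableAt ℝ (christoffelCLM G) y) (u v w : F) :
    coordCurvature G y u v w =
      fderiv ℝ (christoffelCLM G) y u v w - fderiv ℝ (christoffelCLM G) y v u w
      + christoffelCLM G y u (christoffelCLM G y v w)
      - christoffelCLM G y v (christoffelCLM G y u w) := by
  have h (a b c : F) : fderiv ℝ (fun z => christoffel G z a b) y c =
      fderiv ℝ (christoffelCLM G) y c a b := by
    have := ((hG.hasFDerivAt.clm_apply (hasFDerivAt_const a y)).clm_apply
      (hasFDerivAt_const b y)).fderiv
    change fderiv ℝ (fun z => christoffelCLM G z a b) y c = _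
    rw [this]
    simp
  rw [coordCurvature, h, h]
  rfl

/-- A metric near a point of a vector space. -/
structure IsMetricNear (G : F → F →L[ℝ] F →L[ℝ] ℝ) (y : F) : Prop where
  eventually_contDiffAt : ∀ᶠ z in 𝓝 y, ContDiffAt ℝ ∞ G z
  eventually_symm : ∀ᶠ z in 𝓝 y, ∀ u v, G z u v = G z v u
  eventually_invertible : ∀ᶠ z in 𝓝 y, (G z).IsInvertible

theorem IsMetricNear.contDiffAt {G : F → F →L[ℝ] F →L[ℝ] ℝ} {y : F} (h : IsMetricNear G y) :
    ContDiffAt ℝ ∞ G y :=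
  h.eventually_contDiffAt.self_of_nhds

theorem IsMetricNear.eventually {G : F → F →L[ℝ] F →L[ℝ] ℝ} {y : F} (h : IsMetricNear G y) :
    ∀ᶠ z in 𝓝 y, IsMetricNear G z := by
  filter_upwards [h.eventually_contDiffAt.eventually_nhds, h.eventually_symm.eventually_nhds,
    h.eventually_invertible.eventually_nhds] with z h1 h2 h3 using ⟨h1, h2, h3⟩

theorem IsMetricNear.fderiv_symm {G : F → F →L[ℝ] F →L[ℝ] ℝ} {y : F} (h : IsMetricNear G y)
    (a u v : F) : fderiv ℝ G y a u v = fderiv ℝ G y a v u := by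
  have h1 := (h.contDiffAt.hasFDerivAt_infty.clm_apply (hasFDerivAt_const u y)).clm_apply
    (hasFDerivAt_const v y)
  have h2 := (h.contDiffAt.hasFDerivAt_infty.clm_apply (hasFDerivAt_const v y)).clm_apply
    (hasFDerivAt_const u y)
  simpa using h1.unique_of_eventuallyEq h2 (h.eventually_symm.mono fun z hz => hz u v) a

/-- The pullback of the metric `G` by `ψ`. -/
def pullbackMetric (G : F → F →L[ℝ] F →L[ℝ] ℝ) (ψ : F → F) (z : F) : F →L[ℝ] F →L[ℝ] ℝ :=
  (ContinuousLinearMap.precomp ℝ (fderiv ℝ ψ z)) ∘L (G (ψ z)) ∘L (fderiv ℝ ψ z)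

theorem pullbackMetric_apply (G : F → F →L[ℝ] F →L[ℝ] ℝ) (ψ : F → F) (z u v : F) :
    pullbackMetric G ψ z u v = G (ψ z) (fderiv ℝ ψ z u) (fderiv ℝ ψ z v) := rfl

theorem contDiffAt_pullbackMetric {G : F → F →L[ℝ] F →L[ℝ] ℝ} {ψ : F → F} {x : F}
    (hψ : ContDiffAt ℝ ∞ ψ x) (hG : ContDiffAt ℝ ∞ G (ψ x)) :
    ContDiffAt ℝ ∞ (pullbackMetric G ψ) x := by
  have h1 := hψ.contDiffAt_fderiv_infty
  have h2 : ContDiffAt ℝ ∞ (fun z => (ContinuousLinearMap.compL ℝ F F ℝ).flip (fderiv ℝ ψ z)) x :=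
    ((ContinuousLinearMap.compL ℝ F F ℝ).flip).contDiff.contDiffAt.comp x h1
  exact h2.clm_comp ((hG.comp x hψ).clm_comp h1)

theorem fderiv_pullbackMetric {G : F → F →L[ℝ] F →L[ℝ] ℝ} {ψ : F → F} {x : F}
    (hψ : ContDiffAt ℝ ∞ ψ x) (hG : ContDiffAt ℝ ∞ G (ψ x)) (a u v : F) :
    fderiv ℝ (pullbackMetric G ψ) x a u v =
      fderiv ℝ G (ψ x) (fderiv ℝ ψ x a) (fderiv ℝ ψ x u) (fderiv ℝ ψ x v)
      + G (ψ x) (fderiv ℝ (fderiv ℝ ψ) x a u) (fderiv ℝ ψ x v)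
      + G (ψ x) (fderiv ℝ ψ x u) (fderiv ℝ (fderiv ℝ ψ) x a v) := by
  have h1 := ((contDiffAt_pullbackMetric hψ hG).hasFDerivAt_infty.clm_apply
    (hasFDerivAt_const u x)).clm_apply (hasFDerivAt_const v x)
  have hA := hψ.contDiffAt_fderiv_infty.hasFDerivAt_infty
  have h2 := ((hG.hasFDerivAt_infty.comp x hψ.hasFDerivAt_infty).clm_apply
    (hA.clm_apply (hasFDerivAt_const u x))).clm_apply (hA.clm_apply (hasFDerivAt_const v x))
  have := h1.unique_of_eventuallyEq h2 (Eventually.of_forall fun z => rfl) a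
  simp at this
  rw [this]
  ring

section Pullback

variable [CompleteSpace F] {G : F → F →L[ℝ] F →L[ℝ] ℝ} {ψ : F → F} {x : F}
  (hψ : ContDiffAt ℝ ∞ ψ x) (hinv : (fderiv ℝ ψ x).IsInvertible) (hG : IsMetricNear G (ψ x))

include hinv in
omit [CompleteSpace F] in
theorem isInvertible_pullbackMetric (hGx : (G (ψ x)).IsInvertible) :
    (pullbackMetric G ψ x).IsInvertible := by
  obtain ⟨e, he⟩ := hinv
  obtain ⟨g, hg⟩ := hGx
  refine ⟨(e.trans g).trans (e.symm.arrowCongr (ContinuousLinearEquiv.refl ℝ ℝ)), ?_⟩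
  ext u v
  rw [pullbackMetric_apply, ← he, ← hg]
  simp

omit [CompleteSpace F] in
include hψ hinv hG in
-- The classical transformation law. Since `G` is nondegenerate and `dψ` surjective, it can be
-- tested against the vectors `dψ w`; there the symmetry of `D²ψ` cancels all second-derivative
-- terms but one.
theorem christoffel_pullbackMetric (u v : F) :
    fderiv ℝ ψ x (christoffelCLM (pullbackMetric G ψ) x u v) =
      christoffelCLM G (ψ x) (fderiv ℝ ψ x u) (fderiv ℝ ψ x v)
        + fderiv ℝ (fderiv ℝ ψ) x u v := by
  have hGx := hG.eventually_invertible.self_of_nhds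
  have hinj : Function.Injective (G (ψ x)) := by
    obtain ⟨g, hg⟩ := hGx
    rw [← hg]
    exact g.injective
  apply hinj
  ext w'
  obtain ⟨w, rfl⟩ : ∃ w, fderiv ℝ ψ x w = w' := by
    obtain ⟨e, he⟩ := hinv
    exact ⟨e.symm w', by rw [← he]; simp⟩
  rw [← pullbackMetric_apply, christoffelCLM_apply, christoffelCLM_apply,
    apply_christoffel (isInvertible_pullbackMetric hinv hGx), map_add, add_apply,
    apply_christoffel hGx, christoffelForm_apply, christoffelForm_apply,
    fderiv_pullbackMetric hψ hG.contDiffAt, fderiv_pullbackMetric hψ hG.contDiffAt,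
    fderiv_pullbackMetric hψ hG.contDiffAt]
  have hs := hG.eventually_symm.self_of_nhds
  rw [hψ.fderiv_fderiv_comm v u, hψ.fderiv_fderiv_comm w u, hψ.fderiv_fderiv_comm w v,
    hs _ (fderiv ℝ (fderiv ℝ ψ) x v w), hs _ (fderiv ℝ (fderiv ℝ ψ) x u w)]
  ring

include hψ hinv in
theorem eventually_isInvertible_fderiv : ∀ᶠ z in 𝓝 x, (fderiv ℝ ψ z).IsInvertible := by
  obtain ⟨e, he⟩ := hinv
  exact hψ.contDiffAt_fderiv_infty.continuousAt.eventually (he ▸ ContinuousLinearEquiv.nhds e)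

end Pullback

variable [CompleteSpace F] {G : F → F →L[ℝ] F →L[ℝ] ℝ} {ψ : F → F} {x : F}
  (hψ : ∀ᶠ z in 𝓝 x, ContDiffAt ℝ ∞ ψ z) (hinv : (fderiv ℝ ψ x).IsInvertible)
  (hG : IsMetricNear G (ψ x))

include hψ hinv hG

/-- The transformation law holds near `x`, so it may be differentiated; the subtracted term comes
from the factor `dψ` on its left side. -/
theorem fderiv_christoffel_pullbackMetric (c u v : F) :
    fderiv ℝ ψ x (fderiv ℝ (christoffelCLM (pullbackMetric G ψ)) x c u v) =
      fderiv ℝ (christoffelCLM G) (ψ x) (fderiv ℝ ψ x c) (fderiv ℝ ψ x u) (fderiv ℝ ψ x v)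
      + christoffelCLM G (ψ x) (fderiv ℝ (fderiv ℝ ψ) x c u) (fderiv ℝ ψ x v)
      + christoffelCLM G (ψ x) (fderiv ℝ ψ x u) (fderiv ℝ (fderiv ℝ ψ) x c v)
      + fderiv ℝ (fderiv ℝ (fderiv ℝ ψ)) x c u v
      - fderiv ℝ (fderiv ℝ ψ) x c (christoffelCLM (pullbackMetric G ψ) x u v) := by
  have hψx := hψ.self_of_nhds
  have hGx := hG.eventually_invertible.self_of_nhds
  have hu := hasFDerivAt_const (𝕜 := ℝ) u x
  have hv := hasFDerivAt_const (𝕜 := ℝ) v x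
  have hA := hψx.contDiffAt_fderiv_infty.hasFDerivAt_infty
  have h1 := hA.clm_apply (((contDiffAt_christoffelCLM (contDiffAt_pullbackMetric hψx
    hG.contDiffAt) (isInvertible_pullbackMetric hinv hGx)).hasFDerivAt_infty.clm_apply hu).clm_apply
    hv)
  have h2 := ((((contDiffAt_christoffelCLM hG.contDiffAt hGx).hasFDerivAt_infty.comp x
    hψx.hasFDerivAt_infty).clm_apply (hA.clm_apply hu)).clm_apply (hA.clm_apply hv)).add
    ((hψx.contDiffAt_fderiv_infty.contDiffAt_fderiv_infty.hasFDerivAt_infty.clm_apply hu).clm_apply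
      hv)
  have := h1.unique_of_eventuallyEq h2 (by
    filter_upwards [hψ, eventually_isInvertible_fderiv hψx hinv,
      hψx.continuousAt.eventually hG.eventually] with z hz hz2 hz3
    exact christoffel_pullbackMetric hz hz2 hz3 u v) c
  simp at this
  rw [← sub_eq_zero] at this ⊢
  rw [← this]
  abel

/-- The curvature of the pullback of a metric by a local diffeomorphism. -/
theorem fderiv_coordCurvature_pullbackMetric (u v w : F) :
    fderiv ℝ ψ x (coordCurvature (pullbackMetric G ψ) x u v w) =
      coordCurvature G (ψ x) (fderiv ℝ ψ x u) (fderiv ℝ ψ x v) (fderiv ℝ ψ x w) := by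
  have hψx := hψ.self_of_nhds
  have hGx := hG.eventually_invertible.self_of_nhds
  rw [coordCurvature_eq ((contDiffAt_christoffelCLM hG.contDiffAt hGx).differentiableAt (by simp)),
    coordCurvature_eq ((contDiffAt_christoffelCLM (contDiffAt_pullbackMetric hψx hG.contDiffAt)
      (isInvertible_pullbackMetric hinv hGx)).differentiableAt (by simp))]
  simp only [map_add, map_sub, fderiv_christoffel_pullbackMetric hψ hinv hG,
    christoffel_pullbackMetric hψx hinv hG]
  -- The derivatives of `ψ` of order two and three cancel on antisymmetrizing in `u, v`.
  have h3 : fderiv ℝ (fderiv ℝ (fderiv ℝ ψ)) x u v = fderiv ℝ (fderiv ℝ (fderiv ℝ ψ)) x v u :=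
    hψx.contDiffAt_fderiv_infty.fderiv_fderiv_comm u v
  rw [h3, hψx.fderiv_fderiv_comm u v]
  abel

omit hψ hinv hG in
/-- The curvature at a point where the first derivatives of the metric vanish. -/
theorem apply_coordCurvature_of_fderiv_eq_zero {k : F → F →L[ℝ] F →L[ℝ] ℝ}
    (hk : IsMetricNear k x) (h0 : fderiv ℝ k x = 0) (u v : F) :
    k x (coordCurvature k x u v v) u = -(1 / 2 : ℝ) * (fderiv ℝ (fderiv ℝ k) x u u v v
      + fderiv ℝ (fderiv ℝ k) x v v u u - 2 * fderiv ℝ (fderiv ℝ k) x u v u v) := by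
  have hkx := hk.eventually_invertible.self_of_nhds
  have hΓ := contDiffAt_christoffelCLM hk.contDiffAt hkx
  have hΓ0 (a b : F) : christoffelCLM k x a b = 0 := by
    rw [christoffelCLM_apply, christoffel, christoffelForm, h0]
    simp
  have hsymm (a b c d : F) : fderiv ℝ (fderiv ℝ k) x a b c d = fderiv ℝ (fderiv ℝ k) x a b d c := by
    have h1 (c d : F) := ((hk.contDiffAt.contDiffAt_fderiv_infty.hasFDerivAt_infty.clm_apply
      (hasFDerivAt_const b x)).clm_apply (hasFDerivAt_const c x)).clm_apply (hasFDerivAt_const d x)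
    simpa using (h1 c d).unique_of_eventuallyEq (h1 d c)
      (hk.eventually.mono fun z hz => hz.fderiv_symm b c d) a
  -- Differentiating the lowered symbols `k(Γ(a, b), w)` avoids the derivative of the inverse
  -- metric.
  have hD (c a b w : F) : k x (fderiv ℝ (christoffelCLM k) x c a b) w =
      (1 / 2 : ℝ) * (fderiv ℝ (fderiv ℝ k) x c a b w + fderiv ℝ (fderiv ℝ k) x c b a w
        - fderiv ℝ (fderiv ℝ k) x c w a b) := by
    have h1 := ((hk.contDiffAt.hasFDerivAt_infty.clm_apply
      ((hΓ.hasFDerivAt_infty.clm_apply (hasFDerivAt_const a x)).clm_apply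
      (hasFDerivAt_const b x)))).clm_apply (hasFDerivAt_const w x)
    have h2 (a b w : F) := (((hk.contDiffAt.contDiffAt_fderiv_infty.hasFDerivAt_infty.clm_apply
      (hasFDerivAt_const a x)).clm_apply (hasFDerivAt_const b x)).clm_apply (hasFDerivAt_const w x))
    have h3 := (((h2 a b w).add (h2 b a w)).sub (h2 w a b)).const_mul (1 / 2 : ℝ)
    have := h1.unique_of_eventuallyEq h3 (by
      filter_upwards [hk.eventually_invertible] with z hz
      rw [christoffelCLM_apply, apply_christoffel hz, christoffelForm_apply]
      rfl) c
    simpa [h0] using this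
  rw [coordCurvature_eq (hΓ.differentiableAt (by simp))]
  simp only [hΓ0, add_zero, sub_zero, map_sub, sub_apply, hD]
  rw [hk.contDiffAt.fderiv_fderiv_comm v u, hsymm u v v u]
  ring

end CoordinateChange

/-! ## Submersions of a cone with linear fibres, in coordinates -/

section ConicSubmersion

set_option maxSynthPendingDepth 3

variable {E F : Type*} [NormedAddCommGroup E] [NormedSpace ℝ E]
  [NormedAddCommGroup F] [NormedSpace ℝ F]

/-- A map `f`, homogeneous of degree zero on an open set `U` of a scalar product space `(E, q)`,
that induces a submersion of the quadric `q = -1` onto a metric `G`, with horizontal lift `L`, and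
whose Hessian vanishes on the vertical vectors. -/
structure IsConicSubmersion (q : E →L[ℝ] E →L[ℝ] ℝ) (U : Set E) (f : E → F)
    (G : F → F →L[ℝ] F →L[ℝ] ℝ) (L : E → F →L[ℝ] E) : Prop where
  isOpen : IsOpen U
  contDiffOn : ContDiffOn ℝ ∞ f U
  contDiffOn_lift : ContDiffOn ℝ ∞ L U
  isMetricNear : ∀ x ∈ U, IsMetricNear G (f x)
  symm : ∀ a b, q a b = q b a
  pos_metric : ∀ x ∈ U, ∀ u, u ≠ 0 → 0 < G (f x) u u
  -- The factor `-q x x` is `1` on the quadric. For `f` of degree zero it is what homogeneity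
  -- forces: `df` has degree `-1` and `L` degree `1`.
  lift_form : ∀ x ∈ U, ∀ u a, q (L x u) a = -q x x * G (f x) u (fderiv ℝ f x a)
  fderiv_lift : ∀ x ∈ U, ∀ u, fderiv ℝ f x (L x u) = u
  fderiv_self : ∀ x ∈ U, fderiv ℝ f x x = 0
  hessian : ∀ x ∈ U, ∀ V W, fderiv ℝ f x V = 0 → fderiv ℝ f x W = 0 →
    fderiv ℝ (fderiv ℝ f) x V W = 0

namespace IsConicSubmersion

variable {q : E →L[ℝ] E →L[ℝ] ℝ} {U : Set E} {f : E → F}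
  {G : F → F →L[ℝ] F →L[ℝ] ℝ} {L : E → F →L[ℝ] E} (h : IsConicSubmersion q U f G L)
  {x : E} (hx : x ∈ U)

include h hx

theorem contDiffAt : ContDiffAt ℝ ∞ f x := h.contDiffOn.contDiffAt (h.isOpen.mem_nhds hx)

theorem contDiffAt_lift : ContDiffAt ℝ ∞ L x :=
  h.contDiffOn_lift.contDiffAt (h.isOpen.mem_nhds hx)

theorem eventually_mem : ∀ᶠ y in 𝓝 x, y ∈ U := h.isOpen.mem_nhds hx

theorem hasFDerivAt : HasFDerivAt f (fderiv ℝ f x) x := (h.contDiffAt hx).hasFDerivAt_infty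

theorem hasFDerivAt_fderiv : HasFDerivAt (fderiv ℝ f) (fderiv ℝ (fderiv ℝ f) x) x :=
  (h.contDiffAt hx).contDiffAt_fderiv_infty.hasFDerivAt_infty

theorem hasFDerivAt_hessian : HasFDerivAt (fderiv ℝ (fderiv ℝ f))
    (fderiv ℝ (fderiv ℝ (fderiv ℝ f)) x) x :=
  (h.contDiffAt hx).contDiffAt_fderiv_infty.contDiffAt_fderiv_infty.hasFDerivAt_infty

theorem hasFDerivAt_lift : HasFDerivAt L (fderiv ℝ L x) x :=
  (h.contDiffAt_lift hx).hasFDerivAt_infty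

theorem hasFDerivAt_metric : HasFDerivAt (fun y => G (f y)) (fderiv ℝ G (f x) ∘L fderiv ℝ f x) x :=
  (h.isMetricNear x hx).contDiffAt.hasFDerivAt_infty.comp x (h.hasFDerivAt hx)

theorem hessian_comm (a b : E) :
    fderiv ℝ (fderiv ℝ f) x a b = fderiv ℝ (fderiv ℝ f) x b a :=
  (h.contDiffAt hx).fderiv_fderiv_comm a b

theorem third_comm_left (a b c : E) : fderiv ℝ (fderiv ℝ (fderiv ℝ f)) x a b c =
    fderiv ℝ (fderiv ℝ (fderiv ℝ f)) x b a c := by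
  rw [(h.contDiffAt hx).contDiffAt_fderiv_infty.fderiv_fderiv_comm a b]

theorem third_comm_right (a b c : E) : fderiv ℝ (fderiv ℝ (fderiv ℝ f)) x a b c =
    fderiv ℝ (fderiv ℝ (fderiv ℝ f)) x a c b := by
  have h1 := ((h.hasFDerivAt_hessian hx).clm_apply (hasFDerivAt_const b x)).clm_apply
    (hasFDerivAt_const c x)
  have h2 := ((h.hasFDerivAt_hessian hx).clm_apply (hasFDerivAt_const c x)).clm_apply
    (hasFDerivAt_const b x)
  have := h1.unique_of_eventuallyEq h2
    ((h.eventually_mem hx).mono fun y hy => h.hessian_comm hy b c) a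
  simpa using this

omit hx in
theorem hasFDerivAt_form : HasFDerivAt (fun y => q y y) ((2 : ℝ) • q x) x := by
  have := q.hasFDerivAt.clm_apply (hasFDerivAt_id x)
  refine this.congr_fderiv ?_
  ext c
  simp [h.symm c x, two_mul]

/-- This lemma and the next two differentiate once, in turn, the defining identities `fderiv_self`,
`fderiv_lift` and `lift_form`. -/
theorem hessian_self (c : E) : fderiv ℝ (fderiv ℝ f) x c x = -fderiv ℝ f x c := by
  have := ((h.hasFDerivAt_fderiv hx).clm_apply (hasFDerivAt_id x)).unique_of_eventuallyEq
    (hasFDerivAt_const (0 : F) x) ((h.eventually_mem hx).mono fun y hy => h.fderiv_self y hy) c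
  simp only [add_apply, ContinuousLinearMap.comp_apply, ContinuousLinearMap.flip_apply, ContinuousLinearMap.id_apply, zero_apply, id] at this
  exact (neg_eq_of_add_eq_zero_right this).symm

theorem fderiv_fderiv_lift (c : E) (u : F) :
    fderiv ℝ f x (fderiv ℝ L x c u) = -fderiv ℝ (fderiv ℝ f) x c (L x u) := by
  have := ((h.hasFDerivAt_fderiv hx).clm_apply ((h.hasFDerivAt_lift hx).clm_apply
    (hasFDerivAt_const u x))).unique_of_eventuallyEq
    (hasFDerivAt_const u x) ((h.eventually_mem hx).mono fun y hy => h.fderiv_lift y hy u) c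
  simp at this
  exact eq_neg_of_add_eq_zero_left this

theorem form_fderiv_lift (c a : E) (u : F) :
    q (fderiv ℝ L x c u) a = -(2 * q x c) * G (f x) u (fderiv ℝ f x a)
      - q x x * (fderiv ℝ G (f x) (fderiv ℝ f x c) u (fderiv ℝ f x a)
        + G (f x) u (fderiv ℝ (fderiv ℝ f) x c a)) := by
  have h1 := (q.flip a).hasFDerivAt.comp x ((h.hasFDerivAt_lift hx).clm_apply
    (hasFDerivAt_const u x))
  have h2 := (h.hasFDerivAt_form).neg.mul (((h.hasFDerivAt_metric hx).clm_apply
    (hasFDerivAt_const u x)).clm_apply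
    ((h.hasFDerivAt_fderiv hx).clm_apply (hasFDerivAt_const a x)))
  have := h1.unique_of_eventuallyEq h2
    ((h.eventually_mem hx).mono fun y hy => h.lift_form y hy u a) c
  simp at this
  rw [this]
  ring

/-- The vertical part of `∇_X Y`: the Hessian, paired with the metric of the base, is
skew-symmetric up to a radial term. -/
theorem metric_hessian_add {V : E} (hV : fderiv ℝ f x V = 0) (u w : F) :
    q x x * (G (f x) u (fderiv ℝ (fderiv ℝ f) x V (L x w))
      + G (f x) w (fderiv ℝ (fderiv ℝ f) x V (L x u))) = -(2 * q x V) * G (f x) u w := by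
  -- With `a = L w` the left side is again a value of `lift_form`, equal to `q x x * G w (D²f(V, L
  -- u))`; the derivative of `G` drops out because `df V = 0`.
  have h1 := h.form_fderiv_lift hx V (L x w) u
  rw [h.symm, h.lift_form x hx, h.fderiv_fderiv_lift hx, h.fderiv_lift x hx, hV] at h1
  simp at h1
  linarith

theorem metric_hessian_self {V : E} (hV : fderiv ℝ f x V = 0) (u : F) :
    q x x * G (f x) u (fderiv ℝ (fderiv ℝ f) x V (L x u)) = -q x V * G (f x) u u := by
  linarith [h.metric_hessian_add hx hV u u]

omit h hx in
variable (f L) in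
/-- The projection onto the vertical vectors. -/
def vertProj (x : E) : E →L[ℝ] E := ContinuousLinearMap.id ℝ E - L x ∘L fderiv ℝ f x

omit h hx in
theorem vertProj_apply (x a : E) : vertProj f L x a = a - L x (fderiv ℝ f x a) := rfl

theorem contDiffAt_vertProj : ContDiffAt ℝ ∞ (vertProj f L) x :=
  contDiffAt_const.sub ((h.contDiffAt_lift hx).clm_comp
    (h.contDiffAt hx).contDiffAt_fderiv_infty)

theorem hasFDerivAt_vertProj : HasFDerivAt (vertProj f L) (fderiv ℝ (vertProj f L) x) x :=
  (h.contDiffAt_vertProj hx).hasFDerivAt_infty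

theorem fderiv_vertProj (a : E) : fderiv ℝ f x (vertProj f L x a) = 0 := by
  rw [vertProj_apply, map_sub, h.fderiv_lift x hx, sub_self]

omit hx h in
theorem vertProj_of_vertical {V : E} (hV : fderiv ℝ f x V = 0) : vertProj f L x V = V := by
  rw [vertProj_apply, hV, map_zero, sub_zero]

theorem vertProj_lift (u : F) : vertProj f L x (L x u) = 0 := by
  rw [vertProj_apply, h.fderiv_lift x hx, sub_self]

theorem fderiv_fderiv_vertProj (c a : E) : fderiv ℝ f x (fderiv ℝ (vertProj f L) x c a) =
    -fderiv ℝ (fderiv ℝ f) x c (vertProj f L x a) := by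
  have := ((h.hasFDerivAt_fderiv hx).clm_apply ((h.hasFDerivAt_vertProj hx).clm_apply
    (hasFDerivAt_const a x))).unique_of_eventuallyEq
    (hasFDerivAt_const (0 : F) x) ((h.eventually_mem hx).mono fun y hy => h.fderiv_vertProj hy a) c
  simp at this
  exact eq_neg_of_add_eq_zero_left this

/-- Total geodesy kills the vertical part of `a`, so only its horizontal part `L (df a)`
contributes. -/
theorem hessian_vertical {V : E} (hV : fderiv ℝ f x V = 0) (a : E) :
    fderiv ℝ (fderiv ℝ f) x V a = fderiv ℝ (fderiv ℝ f) x V (L x (fderiv ℝ f x a)) := by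
  have := h.hessian x hx V (vertProj f L x a) hV (h.fderiv_vertProj hx a)
  rwa [vertProj_apply, map_sub, sub_eq_zero] at this

/-- Differentiate `D²f(P V, P V) = 0` for the vertical projection `P`. The rotation of the vertical
space enters only through `df (DP(c) V) = -D²f(c, V)`, once for each of the two slots. -/
theorem third_vertical {V : E} (hV : fderiv ℝ f x V = 0) (c : E) :
    fderiv ℝ (fderiv ℝ (fderiv ℝ f)) x c V V =
      (2 : ℝ) • fderiv ℝ (fderiv ℝ f) x V (L x (fderiv ℝ (fderiv ℝ f) x c V)) := by
  have hP := (h.hasFDerivAt_vertProj hx).clm_apply (hasFDerivAt_const V x)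
  have := (((h.hasFDerivAt_hessian hx).clm_apply hP).clm_apply hP).unique_of_eventuallyEq
    (hasFDerivAt_const (0 : F) x) ((h.eventually_mem hx).mono fun y hy =>
      h.hessian y hy _ _ (h.fderiv_vertProj hy V) (h.fderiv_vertProj hy V)) c
  simp [vertProj_of_vertical hV] at this
  rw [h.hessian_comm hx (fderiv ℝ (vertProj f L) x c V) V,
    h.hessian_vertical hx hV (fderiv ℝ (vertProj f L) x c V), h.fderiv_fderiv_vertProj hx,
    vertProj_of_vertical hV, map_neg, map_neg] at this
  rw [two_smul, ← sub_eq_zero, ← this]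
  abel

/-- The curvature identity for planes spanned by a horizontal and a vertical vector. -/
theorem form_vertical {V : E} (hV : fderiv ℝ f x V = 0) (hq : q x x = -1) (hxV : q x V = 0)
    (u : F) : q V V * G (f x) u u = -G (f x) (fderiv ℝ (fderiv ℝ f) x V (L x u))
      (fderiv ℝ (fderiv ℝ f) x V (L x u)) := by
  have hP := (h.hasFDerivAt_vertProj hx).clm_apply (hasFDerivAt_const V x)
  have hG := (h.hasFDerivAt_metric hx).clm_apply (hasFDerivAt_const u x)
  have h1 := (h.hasFDerivAt_form).mul (hG.clm_apply
    (((h.hasFDerivAt_hessian hx).clm_apply hP).clm_apply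
      ((h.hasFDerivAt_lift hx).clm_apply (hasFDerivAt_const u x))))
  have h2 := (q.hasFDerivAt.clm_apply hP).neg.mul (hG.clm_apply (hasFDerivAt_const u x))
  -- `metric_hessian_self` is differentiated along `V`, with `V` extended near `x` by its vertical
  -- projections.
  have h3 := h1.unique_of_eventuallyEq h2 ((h.eventually_mem hx).mono fun y hy =>
    h.metric_hessian_self hy (h.fderiv_vertProj hy V) u) V
  -- The derivative of the extension along `V` is itself vertical, by total geodesy, so
  -- `metric_hessian_self` applies to it and its two contributions cancel.
  have hZ : fderiv ℝ f x (fderiv ℝ (vertProj f L) x V V) = 0 := by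
    rw [h.fderiv_fderiv_vertProj hx, vertProj_of_vertical hV, h.hessian x hx V V hV hV, neg_zero]
  have h4 := h.metric_hessian_self hx hZ u
  have h5 := h.third_vertical hx hV (L x u)
  have h6 : fderiv ℝ (fderiv ℝ f) x V (fderiv ℝ L x V u) =
      -fderiv ℝ (fderiv ℝ f) x V (L x (fderiv ℝ (fderiv ℝ f) x V (L x u))) := by
    rw [h.hessian_vertical hx hV, h.fderiv_fderiv_lift hx, map_neg, map_neg]
  -- What is left is `q(V, V) G(u, u) = G(u, A_V (A_V u))`, where `A_V = D²f(V, L ·)`: twice this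
  -- term comes from `h5` and minus once from `h6`. Skewness of `A_V` gives the sign.
  have h7 := h.metric_hessian_add hx hV u (fderiv ℝ (fderiv ℝ f) x V (L x u))
  rw [h.third_comm_left hx, h.third_comm_right hx, h.hessian_comm hx (L x u)] at h5
  simp [vertProj_of_vertical hV, hV, hxV, hq, h5, h6] at h3 h4 h7
  linarith

theorem form_vertical_nonpos [Nontrivial F] {V : E} (hV : fderiv ℝ f x V = 0) (hq : q x x = -1)
    (hxV : q x V = 0) : q V V ≤ 0 := by
  obtain ⟨u, hu⟩ := exists_ne (0 : F)
  have h1 := h.form_vertical hx hV hq hxV u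
  have h2 := h.pos_metric x hx u hu
  have h3 : 0 ≤ G (f x) (fderiv ℝ (fderiv ℝ f) x V (L x u))
      (fderiv ℝ (fderiv ℝ f) x V (L x u)) := by
    by_cases h0 : fderiv ℝ (fderiv ℝ f) x V (L x u) = 0
    · simp [h0]
    · exact (h.pos_metric x hx _ h0).le
  by_contra! h4
  nlinarith [mul_pos h4 h2]

/-- Differentiate `q(P_y (L_x u), V) = q(L_x u, V) + q(y, y) G(df_y (L_x u), df_y V)` at `y = x`; as
`df_x V = 0`, only the derivative of the last slot survives. Thus the turning of the horizontal
spaces is dual to the maps `A_V = D²f(V, L ·)`. -/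
theorem form_fderiv_vertProj_lift {V : E} (hV : fderiv ℝ f x V = 0) (a u : F) :
    q (fderiv ℝ (vertProj f L) x (L x a) (L x u)) V =
      q x x * G (f x) u (fderiv ℝ (fderiv ℝ f) x V (L x a)) := by
  have h1 := (q.flip V).hasFDerivAt.comp x ((h.hasFDerivAt_vertProj hx).clm_apply
    (hasFDerivAt_const (L x u) x))
  have h2 := ((h.hasFDerivAt_form).mul (((h.hasFDerivAt_metric hx).clm_apply
    ((h.hasFDerivAt_fderiv hx).clm_apply (hasFDerivAt_const (L x u) x))).clm_apply
    ((h.hasFDerivAt_fderiv hx).clm_apply (hasFDerivAt_const V x)))).const_add (q (L x u) V)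
  have := h1.unique_of_eventuallyEq h2
    ((h.eventually_mem hx).mono fun y hy => by
      simp [vertProj_apply, h.lift_form y hy]) (L x a)
  simp [hV, h.fderiv_lift x hx] at this
  rw [this, h.hessian_comm hx]


/-! ### The curvature of the base -/

theorem metric_symm (u v : F) : G (f x) u v = G (f x) v u :=
  (h.isMetricNear x hx).eventually_symm.self_of_nhds u v

omit h hx in
/-- The second fundamental form of the horizontal distribution at `x`, without its radial part. -/
def integrability (f : E → F) (G : F → F →L[ℝ] F →L[ℝ] ℝ) (L : E → F →L[ℝ] E) (x : E) (a u : F) :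
    E := fderiv ℝ (vertProj f L) x (L x a) (L x u) + G (f x) a u • x

theorem fderiv_integrability (a u : F) : fderiv ℝ f x (integrability f G L x a u) = 0 := by
  rw [integrability, map_add, map_smul, h.fderiv_self x hx, smul_zero, add_zero,
    h.fderiv_fderiv_vertProj hx, h.vertProj_lift hx, map_zero, neg_zero]

/-- Skewness of `A_V` up to `q(x, V)`, transferred by `form_fderiv_vertProj_lift`; the summand `G(a,
u) x` in `integrability` cancels exactly this radial defect. -/
theorem form_integrability_add {V : E} (hV : fderiv ℝ f x V = 0) (hq : q x x = -1) (a u : F) :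
    q (integrability f G L x a u) V = -q (integrability f G L x u a) V := by
  have h1 := h.metric_hessian_add hx hV u a
  simp only [integrability, map_add, add_apply, map_smul, smul_apply, smul_eq_mul,
    h.form_fderiv_vertProj_lift hx hV, hq] at h1 ⊢
  rw [h.metric_symm hx a u]
  linarith

/-- The case `V = x` of `form_fderiv_vertProj_lift`, evaluated by the Euler relation `D²f(x, L a) =
-a`. Orthogonality to `x` is what lets `form_vertical_nonpos` apply. -/
theorem form_self_integrability (hq : q x x = -1) (a u : F) :
    q x (integrability f G L x a u) = 0 := by
  rw [h.symm]
  simp only [integrability, map_add, add_apply, map_smul, smul_apply, smul_eq_mul,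
    h.form_fderiv_vertProj_lift hx (h.fderiv_self x hx), hq]
  rw [h.hessian_comm hx, h.hessian_self hx, h.fderiv_lift x hx, h.metric_symm hx a u, map_neg]
  ring

theorem form_fderiv_vertProj (hq : q x x = -1) (a u c v : F) :
    q (fderiv ℝ (vertProj f L) x (L x a) (L x u)) (fderiv ℝ (vertProj f L) x (L x c) (L x v)) =
      q (integrability f G L x a u) (integrability f G L x c v) - G (f x) a u * G (f x) c v := by
  have h1 (a u : F) : fderiv ℝ (vertProj f L) x (L x a) (L x u) =
    integrability f G L x a u - G (f x) a u • x := by simp [integrability]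
  rw [h1, h1]
  simp only [map_sub, sub_apply, map_smul, smul_apply, smul_eq_mul,
    h.form_self_integrability hx hq, h.symm _ x, hq]
  ring

theorem form_lift_lift (hq : q x x = -1) (u v : F) : q (L x u) (L x v) = G (f x) u v := by
  rw [h.lift_form x hx, h.fderiv_lift x hx, hq]
  ring

/-- Pythagoras for the `q`-orthogonal splitting `a = P a + L (df a)`. -/
theorem metric_fderiv (a b : E) : -q x x * G (f x) (fderiv ℝ f x a) (fderiv ℝ f x b) =
    q a b - q (vertProj f L x a) (vertProj f L x b) := by
  have h1 : q (L x (fderiv ℝ f x b)) (vertProj f L x a) = 0 := by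
    rw [h.lift_form x hx, h.fderiv_vertProj hx, map_zero, mul_zero]
  rw [← h.lift_form x hx, vertProj_apply x b, map_sub, h.symm _ (L x (fderiv ℝ f x b)), h1,
    vertProj_apply, map_sub, sub_apply]
  ring

/-! ### The base metric pulled back to an affine horizontal slice -/

omit h hx in
/-- The restriction of `f` to the affine horizontal space at `x`. -/
def slice (f : E → F) (L : E → F →L[ℝ] E) (x : E) (z : F) : F := f (x + L x z)

theorem eventually_slice_mem : ∀ᶠ z in 𝓝 (0 : F), x + L x z ∈ U := by
  have : ContinuousAt (fun z => x + L x z) 0 := by fun_prop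
  exact this.eventually_mem (by simpa using h.isOpen.mem_nhds hx)

omit h hx in
theorem contDiff_add_lift (x : E) : ContDiff ℝ ∞ (fun z => x + L x z) :=
  contDiff_const.add (L x).contDiff

omit hx in
theorem contDiffAt_slice {z : F} (hz : x + L x z ∈ U) : ContDiffAt ℝ ∞ (slice f L x) z :=
  (h.contDiffAt hz).comp z (contDiff_add_lift x).contDiffAt

omit h hx in
theorem hasFDerivAt_add_lift (z : F) : HasFDerivAt (fun z => x + L x z) (L x) z :=
  (L x).hasFDerivAt.const_add x

omit hx in
theorem fderiv_slice {z : F} (hz : x + L x z ∈ U) :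
    fderiv ℝ (slice f L x) z = fderiv ℝ f (x + L x z) ∘L L x :=
  ((h.hasFDerivAt hz).comp z (hasFDerivAt_add_lift z)).fderiv

theorem fderiv_slice_zero : fderiv ℝ (slice f L x) 0 = ContinuousLinearMap.id ℝ F := by
  rw [h.fderiv_slice (by simpa using hx)]
  ext u
  simp [h.fderiv_lift x hx]

theorem isInvertible_fderiv_slice_zero : (fderiv ℝ (slice f L x) 0).IsInvertible := by
  rw [h.fderiv_slice_zero hx]
  exact ⟨ContinuousLinearEquiv.refl ℝ F, rfl⟩

omit h hx in
theorem slice_zero : slice f L x 0 = f x := by simp [slice]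

theorem eventually_contDiffAt_slice : ∀ᶠ z in 𝓝 (0 : F), ContDiffAt ℝ ∞ (slice f L x) z :=
  (h.eventually_slice_mem hx).mono fun _ hz => h.contDiffAt_slice hz

theorem isMetricNear_pullback [CompleteSpace F] :
    IsMetricNear (pullbackMetric G (slice f L x)) 0 := by
  refine ⟨?_, ?_, ?_⟩
  · exact (h.eventually_slice_mem hx).mono fun z hz =>
      contDiffAt_pullbackMetric (h.contDiffAt_slice hz) (h.isMetricNear _ hz).contDiffAt
  · exact (h.eventually_slice_mem hx).mono fun z hz u v => by
      rw [pullbackMetric_apply, pullbackMetric_apply]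
      exact h.metric_symm hz _ _
  · filter_upwards [h.eventually_slice_mem hx, eventually_isInvertible_fderiv
      (h.eventually_contDiffAt_slice hx).self_of_nhds (h.isInvertible_fderiv_slice_zero hx)]
      with z hz hz'
    exact isInvertible_pullbackMetric hz'
      (h.isMetricNear _ hz).eventually_invertible.self_of_nhds

omit h hx in
/-- The vertical projection along the affine horizontal space at `x`. -/
def sliceProj (f : E → F) (L : E → F →L[ℝ] E) (x : E) (z : F) : F →L[ℝ] E :=
  vertProj f L (x + L x z) ∘L L x

omit hx in
theorem contDiffAt_sliceProj {z : F} (hz : x + L x z ∈ U) :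
    ContDiffAt ℝ ∞ (sliceProj f L x) z := by
  have : ContDiffAt ℝ ∞ (fun z => vertProj f L (x + L x z)) z :=
    ContDiffAt.comp (g := vertProj f L) (f := fun z => x + L x z) z (h.contDiffAt_vertProj hz)
      (contDiff_add_lift x).contDiffAt
  exact this.clm_comp contDiffAt_const

theorem sliceProj_zero : sliceProj f L x 0 = 0 := by
  ext u
  simp [sliceProj, h.vertProj_lift hx]

theorem fderiv_sliceProj_zero (a u : F) : fderiv ℝ (sliceProj f L x) 0 a u =
    fderiv ℝ (vertProj f L) x (L x a) (L x u) := by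
  have hx' : x + L x 0 ∈ U := by simpa using hx
  have := ((h.hasFDerivAt_vertProj hx').comp 0 (hasFDerivAt_add_lift 0)).clm_comp
    (hasFDerivAt_const (L x) 0)
  change HasFDerivAt (sliceProj f L x) _ 0 at this
  rw [this.fderiv]
  simp

/-- Pythagoras at `x + L z` for the fixed vectors `L u, L v`. The pullback becomes explicit: a
scalar factor stationary at `0`, and a correction quadratic in `sliceProj`, which vanishes at `0`.
-/
theorem pullbackMetric_slice (hq : q x x = -1) {z : F} (hz : x + L x z ∈ U) (u v : F) :
    -q (x + L x z) (x + L x z) * pullbackMetric G (slice f L x) z u v =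
      G (f x) u v - q (sliceProj f L x z u) (sliceProj f L x z v) := by
  rw [pullbackMetric_apply, h.fderiv_slice hz, ← h.form_lift_lift hx hq]
  exact h.metric_fderiv hz _ _

/-- Stated on the whole slice and without dividing by the scalar factor, so that it can be
differentiated again. -/
theorem fderiv_pullbackMetric_slice [CompleteSpace F] (hq : q x x = -1) {z : F}
    (hz : x + L x z ∈ U) (c u v : F) :
    -q (x + L x z) (x + L x z) * fderiv ℝ (pullbackMetric G (slice f L x)) z c u v
      - 2 * q (x + L x z) (L x c) * pullbackMetric G (slice f L x) z u v =
      -(q (fderiv ℝ (sliceProj f L x) z c u) (sliceProj f L x z v)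
        + q (sliceProj f L x z u) (fderiv ℝ (sliceProj f L x) z c v)) := by
  have hu := hasFDerivAt_const (𝕜 := ℝ) u z
  have hv := hasFDerivAt_const (𝕜 := ℝ) v z
  have hN := (h.contDiffAt_sliceProj hz).hasFDerivAt_infty
  have h1 := (h.hasFDerivAt_form.comp z (hasFDerivAt_add_lift (L := L) (x := x) z)).neg.mul
    (((contDiffAt_pullbackMetric (h.contDiffAt_slice hz)
    (h.isMetricNear _ hz).contDiffAt).hasFDerivAt_infty.clm_apply hu).clm_apply hv)
  have h2 := ((q.hasFDerivAt.comp z (hN.clm_apply hu)).clm_apply (hN.clm_apply hv)).const_sub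
    (G (f x) u v)
  have := h1.unique_of_eventuallyEq h2 (by
    filter_upwards [(hasFDerivAt_add_lift z).continuousAt.eventually_mem
      (h.isOpen.mem_nhds hz)] with y hy
    exact h.pullbackMetric_slice hx hq hy u v) c
  simp at this
  simp only [map_add, add_apply]
  linarith

theorem fderiv_pullbackMetric_slice_zero [CompleteSpace F] (hq : q x x = -1) :
    fderiv ℝ (pullbackMetric G (slice f L x)) 0 = 0 := by
  ext c u v
  have h1 := h.fderiv_pullbackMetric_slice hx hq (z := 0) (by simpa using hx) c u v
  simpa [h.sliceProj_zero hx, hq, h.symm x, h.lift_form x hx, h.fderiv_self x hx] using h1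

/-- The term `2 G(a, c) G(u, v)` is the Hessian of `q(y, y)` along the slice; the others are
products of two first derivatives of `sliceProj`, since `sliceProj` itself is zero at `0`. -/
theorem fderiv_fderiv_pullbackMetric_slice_zero [CompleteSpace F] (hq : q x x = -1)
    (a c u v : F) :
    fderiv ℝ (fderiv ℝ (pullbackMetric G (slice f L x))) 0 a c u v =
      2 * G (f x) a c * G (f x) u v
        - (q (integrability f G L x c u) (integrability f G L x a v)
          + q (integrability f G L x a u) (integrability f G L x c v)
          - G (f x) c u * G (f x) a v - G (f x) a u * G (f x) c v) := by
  have hx' : x + L x 0 ∈ U := by simpa using hx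
  have hc := hasFDerivAt_const (𝕜 := ℝ) c (0 : F)
  have hu := hasFDerivAt_const (𝕜 := ℝ) u (0 : F)
  have hv := hasFDerivAt_const (𝕜 := ℝ) v (0 : F)
  have hN := (h.contDiffAt_sliceProj hx').hasFDerivAt_infty
  have hN' := (h.contDiffAt_sliceProj hx').contDiffAt_fderiv_infty.hasFDerivAt_infty
  have hk := (h.isMetricNear_pullback hx).contDiffAt
  have hs := hasFDerivAt_add_lift (L := L) (x := x) 0
  have h1 := ((h.hasFDerivAt_form.comp 0 hs).neg.mul
    (((hk.contDiffAt_fderiv_infty.hasFDerivAt_infty.clm_apply hc).clm_apply hu).clm_apply hv)).sub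
    ((((q.hasFDerivAt.comp 0 hs).clm_apply (hasFDerivAt_const (L x c) 0)).const_mul 2).mul
      ((hk.hasFDerivAt_infty.clm_apply hu).clm_apply hv))
  have h2 := (((q.hasFDerivAt.comp 0 ((hN'.clm_apply hc).clm_apply hu)).clm_apply
    (hN.clm_apply hv)).add ((q.hasFDerivAt.comp 0 (hN.clm_apply hu)).clm_apply
      ((hN'.clm_apply hc).clm_apply hv))).neg
  have := h1.unique_of_eventuallyEq h2 (by
    filter_upwards [h.eventually_slice_mem hx] with y hy
    exact h.fderiv_pullbackMetric_slice hx hq hy c u v) a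
  simp [h.sliceProj_zero hx, hq, h.symm x, h.lift_form x hx, h.fderiv_self x hx,
    h.fderiv_lift x hx, h.fderiv_sliceProj_zero hx, h.form_fderiv_vertProj hx hq,
    pullbackMetric_apply, h.fderiv_slice_zero hx, slice_zero,
    h.fderiv_pullbackMetric_slice_zero hx hq] at this
  linarith

/-- O'Neill's formula for the curvature of the base. -/
theorem curvature_formula [CompleteSpace F] (hq : q x x = -1) (u v : F) :
    G (f x) (coordCurvature G (f x) u v v) u =
      -(G (f x) u u * G (f x) v v - G (f x) u v ^ 2)
        + 3 * q (integrability f G L x u v) (integrability f G L x u v) := by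
  have h1 := apply_coordCurvature_of_fderiv_eq_zero (h.isMetricNear_pullback hx)
    (h.fderiv_pullbackMetric_slice_zero hx hq) u v
  have h2 := fderiv_coordCurvature_pullbackMetric (h.eventually_contDiffAt_slice hx)
    (h.isInvertible_fderiv_slice_zero hx) (slice_zero (f := f) (L := L) ▸ h.isMetricNear x hx) u v v
  simp only [slice_zero, h.fderiv_slice_zero hx, ContinuousLinearMap.id_apply] at h2
  simp only [h.fderiv_fderiv_pullbackMetric_slice_zero hx hq, pullbackMetric_apply,
    slice_zero, h2, h.fderiv_slice_zero hx, ContinuousLinearMap.id_apply] at h1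
  -- The tensor is skew when paired with vertical vectors, its own values included: `q(I(v, u), I(u,
  -- v)) = -q(I(u, v), I(u, v))`, and the pairing of `I(u, u)` with `I(v, v)` is zero.
  have hv := h.fderiv_integrability hx
  have e1 := h.form_integrability_add hx (hv u v) hq u v
  have e2 := h.form_integrability_add hx (hv v u) hq u v
  have e3 := h.form_integrability_add hx (hv v v) hq u u
  rw [h.symm (integrability f G L x v u) (integrability f G L x u v)] at e1
  rw [h1, h.metric_symm hx v u]
  rw [h.symm (integrability f G L x v u) (integrability f G L x u v)]
  linarith

/-- The integrability term in O'Neill's formula is a nonpositive vertical norm, and the other term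
is minus the Gram determinant. -/
theorem coordSectionalCurvature_neg [CompleteSpace F] (hq : q x x = -1) {u v : F}
    (huv : LinearIndependent ℝ ![u, v]) : coordSectionalCurvature G (f x) u v < 0 := by
  have hv : v ≠ 0 := huv.ne_zero 1
  have : Nontrivial F := ⟨v, 0, hv⟩
  have h1 := h.form_vertical_nonpos hx (h.fderiv_integrability hx u v) hq
    (h.form_self_integrability hx hq u v)
  have hvv := h.pos_metric x hx v hv
  -- The norm of this vector, a multiple of the part of `u` orthogonal to `v`, is `G(v, v)` times
  -- the Gram determinant.
  have hw : G (f x) v v • u - G (f x) u v • v ≠ 0 := by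
    intro h0
    have := LinearIndependent.pair_iff.1 huv (G (f x) v v) (-G (f x) u v)
      (by rw [neg_smul, ← sub_eq_add_neg]; exact h0)
    exact hvv.ne' this.1
  have hww := h.pos_metric x hx _ hw
  simp only [map_sub, sub_apply, map_smul, smul_apply, smul_eq_mul, h.metric_symm hx v u] at hww
  have hD : 0 < G (f x) u u * G (f x) v v - G (f x) u v ^ 2 := by
    refine pos_of_mul_pos_right (a := G (f x) v v) ?_ hvv.le
    linarith
  rw [coordSectionalCurvature, h.curvature_formula hx hq]
  exact div_neg_of_neg_of_pos (by linarith) hD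

end IsConicSubmersion

end ConicSubmersion

/-! ## The pseudo-hyperbolic space in its charts -/

namespace PseudoHyperbolicSpace

set_option maxSynthPendingDepth 3

variable {m s : ℕ}

local notation "𝔼" => EuclideanSpace ℝ (Fin (m + 1))
local notation "𝔽" => EuclideanSpace ℝ (Fin m)

theorem incl_injective : Function.Injective (incl : PseudoHyperbolicSpace m s → 𝔼) :=
  Subtype.val_injective

theorem mem_chart_target_zero (y : PseudoHyperbolicSpace m s) : (0 : 𝔽) ∈ y.chart.target := by
  rw [← chart_self y]
  exact y.chart.map_source (mem_chart_source 𝔽 y)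

theorem contDiffAt_graph (y : PseudoHyperbolicSpace m s) {w : 𝔽} (hw : w ∈ y.chart.target) :
    ContDiffAt ℝ ∞ y.graph w :=
  y.contDiffOn_graph.contDiffAt (y.isOpen_chartTarget.mem_nhds hw)

theorem graph_zero (y : PseudoHyperbolicSpace m s) : y.graph 0 = y.incl := by
  simp [graph]

theorem fderiv_graph (y : PseudoHyperbolicSpace m s) {w : 𝔽} (hw : w ∈ y.chart.target) (a : 𝔽) :
    fderiv ℝ y.graph w a = y.emb a +
      ((√(1 + pseudoForm m s (y.emb w) (y.emb w)))⁻¹ * pseudoForm m s (y.emb w) (y.emb a)) •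
        y.incl := by
  have hw' : 0 < 1 + pseudoForm m s (y.emb w) (y.emb w) := hw
  have h1 : HasFDerivAt (fun w : 𝔽 => pseudoForm m s (y.emb w)) ((pseudoForm m s) ∘L y.emb) w :=
    ((pseudoForm m s) ∘L y.emb).hasFDerivAt
  have h2 := ((h1.clm_apply y.emb.hasFDerivAt).const_add 1).sqrt hw'.ne'
  have h3 := y.emb.hasFDerivAt.add (h2.smul_const y.incl)
  have h4 : HasFDerivAt y.graph _ w := h3
  rw [h4.fderiv]
  simp [pseudoForm_symm (y.emb a)]
  congr 1
  ring

theorem fderiv_graph_zero (y : PseudoHyperbolicSpace m s) : fderiv ℝ y.graph 0 = y.emb := by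
  ext1 a
  rw [y.fderiv_graph y.mem_chart_target_zero]
  simp

/-- The second derivative at the centre is purely radial: it is the second fundamental form of the
quadric. -/
theorem fderiv_fderiv_graph_zero (y : PseudoHyperbolicSpace m s) (c a : 𝔽) :
    fderiv ℝ (fderiv ℝ y.graph) 0 c a = pseudoForm m s (y.emb c) (y.emb a) • y.incl := by
  have h0 := y.mem_chart_target_zero
  have h1 := (y.contDiffAt_graph h0).contDiffAt_fderiv_infty.hasFDerivAt_infty.clm_apply
    (hasFDerivAt_const a 0)
  have h2 : HasFDerivAt (fun w : 𝔽 => 1 + pseudoForm m s (y.emb w) (y.emb w))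
      (0 : 𝔽 →L[ℝ] ℝ) 0 := by
    have h1 : HasFDerivAt (fun w : 𝔽 => pseudoForm m s (y.emb w)) ((pseudoForm m s) ∘L y.emb) 0 :=
      ((pseudoForm m s) ∘L y.emb).hasFDerivAt
    refine ((h1.clm_apply y.emb.hasFDerivAt).const_add 1).congr_fderiv ?_
    ext w
    simp
  have h3 := (((hasDerivAt_inv (by simp)).comp_hasFDerivAt _ (h2.sqrt (by simp))).fun_mul
    (((pseudoForm m s).flip (y.emb a) ∘L y.emb).hasFDerivAt)).smul_const y.incl
  have := h1.unique_of_eventuallyEq (h3.const_add (y.emb a)) (by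
    filter_upwards [y.chart.open_target.mem_nhds h0] with w hw
    exact y.fderiv_graph hw a) c
  simpa using this

theorem extChartAt_symm_incl (y : PseudoHyperbolicSpace m s) {w : 𝔽} (hw : w ∈ y.chart.target) :
    ((extChartAt 𝓘(ℝ, 𝔽) y).symm w).incl = y.graph w := y.incl_chart_symm hw

theorem extChartAt_target_eq (y : PseudoHyperbolicSpace m s) :
    (extChartAt 𝓘(ℝ, 𝔽) y).target = y.chart.target := by
  rw [extChartAt_target]
  simp
  rfl

theorem extChartAt_self (y : PseudoHyperbolicSpace m s) : extChartAt 𝓘(ℝ, 𝔽) y y = 0 := y.chart_self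

/-- The differential of the inverse of the chart at `y`. -/
def dChartSymm (y : PseudoHyperbolicSpace m s) (w : 𝔽) : 𝔽 →L[ℝ] 𝔽 :=
  mfderiv 𝓘(ℝ, 𝔽) 𝓘(ℝ, 𝔽) (extChartAt 𝓘(ℝ, 𝔽) y).symm w

theorem mdifferentiableAt_extChartAt_symm (y : PseudoHyperbolicSpace m s) {w : 𝔽}
    (hw : w ∈ y.chart.target) :
    MDifferentiableAt 𝓘(ℝ, 𝔽) 𝓘(ℝ, 𝔽) (extChartAt 𝓘(ℝ, 𝔽) y).symm w := by
  rw [← mdifferentiableWithinAt_univ]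
  have := mdifferentiableWithinAt_extChartAt_symm (I := 𝓘(ℝ, 𝔽)) (x := y) (z := w)
    (by rwa [extChartAt_target_eq])
  rwa [modelWithCornersSelf_coe, range_id] at this

theorem emb_dChartSymm (y : PseudoHyperbolicSpace m s) {w : 𝔽} (hw : w ∈ y.chart.target)
    (a : 𝔽) : ((extChartAt 𝓘(ℝ, 𝔽) y).symm w).emb (y.dChartSymm w a) =
      fderiv ℝ y.graph w a := by
  have hi : MDifferentiableAt 𝓘(ℝ, 𝔽) 𝓘(ℝ, 𝔼) (incl : PseudoHyperbolicSpace m s → 𝔼)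
    ((extChartAt 𝓘(ℝ, 𝔽) y).symm w) := (contMDiff_incl _).mdifferentiableAt (by simp)
  have h2 : HasFDerivAt (incl ∘ (extChartAt 𝓘(ℝ, 𝔽) y).symm)
      (((extChartAt 𝓘(ℝ, 𝔽) y).symm w).dIncl ∘L y.dChartSymm w) w :=
    (hi.hasMFDerivAt.comp w (y.mdifferentiableAt_extChartAt_symm hw).hasMFDerivAt).hasFDerivAt
  have h3 := h2.unique_of_eventuallyEq (y.contDiffAt_graph hw).hasFDerivAt_infty (by
    filter_upwards [y.chart.open_target.mem_nhds hw] with z hz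
    exact y.extChartAt_symm_incl hz) a
  rw [← h3]
  exact (dIncl_apply _ _).symm

theorem emb_injective (y : PseudoHyperbolicSpace m s) : Function.Injective y.emb :=
  fun _ _ h => y.perpEquiv.symm.injective (Subtype.ext h)

theorem extChartAt_symm_zero (y : PseudoHyperbolicSpace m s) :
    (extChartAt 𝓘(ℝ, 𝔽) y).symm 0 = y := by
  rw [← y.extChartAt_self]
  exact extChartAt_to_inv y

theorem dChartSymm_zero (y : PseudoHyperbolicSpace m s) :
    y.dChartSymm 0 = ContinuousLinearMap.id ℝ 𝔽 := by
  ext1 a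
  have h1 := y.emb_dChartSymm y.mem_chart_target_zero a
  rw [fderiv_graph_zero, extChartAt_symm_zero] at h1
  exact y.emb_injective h1

theorem metric_inner (y : PseudoHyperbolicSpace m s) (u v : 𝔽) :
    (metric m s).inner y u v = pseudoForm m s (y.emb u) (y.emb v) :=
  congrArg₂ (fun a b => pseudoForm m s a b) (y.dIncl_apply u) (y.dIncl_apply v)

theorem coord_metric_apply (y : PseudoHyperbolicSpace m s) {w : 𝔽} (hw : w ∈ y.chart.target)
    (a b : 𝔽) : (metric m s).coord y w a b =
      pseudoForm m s (fderiv ℝ y.graph w a) (fderiv ℝ y.graph w b) := by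
  rw [← y.emb_dChartSymm hw, ← y.emb_dChartSymm hw]
  exact metric_inner ((extChartAt 𝓘(ℝ, 𝔽) y).symm w) (y.dChartSymm w a) (y.dChartSymm w b)

/-- The second derivatives of `graph` are radial and its first derivatives are orthogonal to `y`, so
all terms vanish. To first order the chart at `y` is a normal chart. -/
theorem fderiv_coord_metric_zero (y : PseudoHyperbolicSpace m s) :
    fderiv ℝ ((metric m s).coord y) 0 = 0 := by
  -- Smoothness need not be known here, because `fderiv` is zero where there is no derivative.
  by_cases hd : DifferentiableAt ℝ ((metric m s).coord y) 0
  · have h0 := y.mem_chart_target_zero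
    ext c a b
    have h1 := (hd.hasFDerivAt.clm_apply (hasFDerivAt_const a 0)).clm_apply (hasFDerivAt_const b 0)
    have hg := (y.contDiffAt_graph h0).contDiffAt_fderiv_infty.hasFDerivAt_infty
    have h2 := ((pseudoForm m s).hasFDerivAt.comp 0 (hg.clm_apply (hasFDerivAt_const a 0))).clm_apply
      (hg.clm_apply (hasFDerivAt_const b 0))
    have := h1.unique_of_eventuallyEq h2 (by
      filter_upwards [y.chart.open_target.mem_nhds h0] with w hw
      exact y.coord_metric_apply hw a b) c
    simpa [fderiv_fderiv_graph_zero, fderiv_graph_zero, pseudoForm_emb,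
      pseudoForm_symm _ y.incl] using this
  · exact fderiv_zero_of_not_differentiableAt hd

theorem christoffel_coord_metric_zero (y : PseudoHyperbolicSpace m s) (u v : 𝔽) :
    christoffel ((metric m s).coord y) 0 u v = 0 := by
  rw [christoffel, christoffelForm, fderiv_coord_metric_zero]
  simp

/-! ### The projection of the cone onto the pseudo-hyperbolic space -/

open Classical in
/-- The radial projection of `{⟨x, x⟩ < 0}` onto `H^m_s`. -/
def ofCone (p : PseudoHyperbolicSpace m s) (x : 𝔼) : PseudoHyperbolicSpace m s :=
  -- Off the cone the value `p` is a dummy.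
  if hx : pseudoForm m s x x < 0 then mk ((√(-pseudoForm m s x x))⁻¹ • x) (by
    have := Real.mul_self_sqrt (neg_pos.2 hx).le
    have h0 := Real.sqrt_pos.2 (neg_pos.2 hx)
    simp only [map_smul, smul_apply, smul_eq_mul]
    field_simp
    linarith) else p

theorem incl_ofCone (p : PseudoHyperbolicSpace m s) {x : 𝔼} (hx : pseudoForm m s x x < 0) :
    (ofCone p x).incl = (√(-pseudoForm m s x x))⁻¹ • x := by
  rw [ofCone, dif_pos hx, incl_mk]

theorem smul_incl_ofCone (p : PseudoHyperbolicSpace m s) {x : 𝔼} (hx : pseudoForm m s x x < 0) :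
    √(-pseudoForm m s x x) • (ofCone p x).incl = x := by
  rw [incl_ofCone p hx, smul_smul, mul_inv_cancel₀ (Real.sqrt_pos.2 (neg_pos.2 hx)).ne', one_smul]

theorem pseudoForm_smul_incl_neg (y : PseudoHyperbolicSpace m s) {r : ℝ} (hr : 0 < r) :
    pseudoForm m s (r • y.incl) (r • y.incl) < 0 := by
  simp only [map_smul, smul_apply, smul_eq_mul, y.pseudoForm_incl]
  nlinarith

theorem ofCone_smul_incl (p y : PseudoHyperbolicSpace m s) {r : ℝ} (hr : 0 < r) :
    ofCone p (r • y.incl) = y := by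
  apply incl_injective
  rw [incl_ofCone p (y.pseudoForm_smul_incl_neg hr)]
  simp only [map_smul, smul_apply, smul_eq_mul, y.pseudoForm_incl, mul_neg, mul_one, neg_neg,
    Real.sqrt_mul_self hr.le, smul_smul, inv_mul_cancel₀ hr.ne', one_smul]

theorem pseudoForm_incl_neg (y : PseudoHyperbolicSpace m s) :
    pseudoForm m s y.incl y.incl < 0 := by
  rw [y.pseudoForm_incl]; norm_num

theorem ofCone_incl (p y : PseudoHyperbolicSpace m s) : ofCone p y.incl = y := by
  simpa using ofCone_smul_incl p y one_pos

theorem isOpen_cone : IsOpen {x : 𝔼 | pseudoForm m s x x < 0} :=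
  isOpen_lt (by fun_prop) continuous_const

theorem contDiffAt_sqrt_form {x : 𝔼} (hx : pseudoForm m s x x < 0) :
    ContDiffAt ℝ ∞ (fun x : 𝔼 => √(-pseudoForm m s x x)) x := by
  refine ContDiffAt.sqrt ?_ (neg_pos.2 hx).ne'
  exact (((pseudoForm m s).contDiff.clm_apply contDiff_id).neg).contDiffAt

/-- The charts of `H^m_s` are restrictions of linear maps of `ℝ^{m+1}`. -/
theorem contMDiffAt_of_incl {X : Type*} [NormedAddCommGroup X] [NormedSpace ℝ X]
    {F : X → PseudoHyperbolicSpace m s} {x : X} (hF : ContDiffAt ℝ ∞ (fun z => (F z).incl) x) :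
    ContMDiffAt 𝓘(ℝ, X) 𝓘(ℝ, 𝔽) ∞ F x := by
  rw [contMDiffAt_iff_target]
  constructor
  · exact (show Topology.IsInducing (incl : PseudoHyperbolicSpace m s → 𝔼) from
      Topology.IsInducing.subtypeVal).continuousAt_iff.2 hF.continuousAt
  · exact (((F x).perpEquiv.contDiff.comp (F x).proj.contDiff).contDiffAt.comp x hF).contMDiffAt

theorem contMDiffAt_ofCone (p : PseudoHyperbolicSpace m s) {x : 𝔼} (hx : pseudoForm m s x x < 0) :
    ContMDiffAt 𝓘(ℝ, 𝔼) 𝓘(ℝ, 𝔽) ∞ (ofCone p) x := by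
  apply contMDiffAt_of_incl
  refine ContDiffAt.congr_of_eventuallyEq (f := fun x : 𝔼 => (√(-pseudoForm m s x x))⁻¹ • x) ?_ ?_
  · exact ((contDiffAt_sqrt_form hx).inv (Real.sqrt_pos.2 (neg_pos.2 hx)).ne').smul contDiffAt_id
  · filter_upwards [isOpen_cone.mem_nhds hx] with z hz
    exact incl_ofCone p hz

/-- The differential of the radial projection. -/
def dOfCone (p : PseudoHyperbolicSpace m s) (x : 𝔼) : 𝔼 →L[ℝ] 𝔽 :=
  mfderiv 𝓘(ℝ, 𝔼) 𝓘(ℝ, 𝔽) (ofCone p) x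

/-- A vector at `x` is the sum of a tangent vector and a radial one. -/
theorem exists_eq_emb_add (p : PseudoHyperbolicSpace m s) {x : 𝔼} (hx : pseudoForm m s x x < 0)
    (a : 𝔼) : ∃ c : ℝ, a = √(-pseudoForm m s x x) • (ofCone p x).emb (dOfCone p x a) + c • x := by
  have h1 := (contDiffAt_sqrt_form hx).hasFDerivAt_infty
  have hm := (contMDiffAt_ofCone p hx).mdifferentiableAt (by simp)
  have hi : MDifferentiableAt 𝓘(ℝ, 𝔽) 𝓘(ℝ, 𝔼) (incl : PseudoHyperbolicSpace m s → 𝔼)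
    (ofCone p x) := (contMDiff_incl _).mdifferentiableAt (by simp)
  have h2 : HasFDerivAt (incl ∘ ofCone p) ((ofCone p x).dIncl ∘L dOfCone p x) x :=
    (hi.hasMFDerivAt.comp x hm.hasMFDerivAt).hasFDerivAt
  -- Differentiate `√(-⟨x, x⟩) • incl (ofCone p x) = x`; the derivative of the scalar gives the
  -- radial component.
  have h3 := (h1.smul h2).unique_of_eventuallyEq (hasFDerivAt_id x) (by
    filter_upwards [isOpen_cone.mem_nhds hx] with z hz
    exact smul_incl_ofCone p hz) a
  set d := fderiv ℝ (fun x : 𝔼 => √(-pseudoForm m s x x)) x a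
  refine ⟨d * (√(-pseudoForm m s x x))⁻¹, ?_⟩
  rw [mul_smul, ← incl_ofCone p hx]
  rw [← dIncl_apply]
  exact h3.symm

theorem form_emb_self (p : PseudoHyperbolicSpace m s) {x : 𝔼} (hx : pseudoForm m s x x < 0)
    (v : 𝔽) : pseudoForm m s ((ofCone p x).emb v) x = 0 := by
  have h := (pseudoForm_symm _ _).trans ((ofCone p x).pseudoForm_emb v)
  rw [incl_ofCone p hx, map_smul, smul_eq_mul] at h
  exact (mul_eq_zero.1 h).resolve_left (inv_pos.2 (Real.sqrt_pos.2 (neg_pos.2 hx))).ne'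

/-- Uniqueness in `exists_eq_emb_add`: pairing with `x` recovers the radial coefficient, and `emb`
is injective. -/
theorem dOfCone_smul_emb (p : PseudoHyperbolicSpace m s) {x : 𝔼} (hx : pseudoForm m s x x < 0)
    (v : 𝔽) (c : ℝ) :
    dOfCone p x (√(-pseudoForm m s x x) • (ofCone p x).emb v + c • x) = v := by
  set a := √(-pseudoForm m s x x) • (ofCone p x).emb v + c • x with ha
  obtain ⟨d, hd⟩ := exists_eq_emb_add p hx a
  have h1 : pseudoForm m s a x = c * pseudoForm m s x x := by
    rw [ha, map_add, add_apply, map_smul, smul_apply, form_emb_self p hx]; simp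
  have h2 : pseudoForm m s a x = d * pseudoForm m s x x := by
    rw [hd, map_add, add_apply, map_smul, smul_apply, form_emb_self p hx]; simp
  have h3 : c = d := mul_right_cancel₀ hx.ne (h1.symm.trans h2)
  conv_lhs at hd => rw [ha, h3]
  have h4 := smul_right_injective 𝔼 (Real.sqrt_pos.2 (neg_pos.2 hx)).ne' (add_right_cancel hd)
  exact ((ofCone p x).emb_injective h4).symm

theorem dOfCone_self (p : PseudoHyperbolicSpace m s) {x : 𝔼} (hx : pseudoForm m s x x < 0) :
    dOfCone p x x = 0 := by
  have := dOfCone_smul_emb p hx 0 1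
  rwa [map_zero, smul_zero, zero_add, one_smul] at this

end PseudoHyperbolicSpace

/-! ## Semi-Riemannian metrics in the charts of a manifold -/

section MetricInChart

set_option maxSynthPendingDepth 3

variable {E : Type*} [NormedAddCommGroup E] [NormedSpace ℝ E]
  {M : Type*} [TopologicalSpace M] [ChartedSpace E M] [IsManifold 𝓘(ℝ, E) ∞ M]

theorem isInvertible_of_nondegenerate [FiniteDimensional ℝ E]
    {Q : E →L[ℝ] E →L[ℝ] ℝ} (hQ : ∀ u, (∀ v, Q u v = 0) → u = 0) : Q.IsInvertible := by
  have hinj : Function.Injective Q.toLinearMap := by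
    rw [← LinearMap.ker_eq_bot, LinearMap.ker_eq_bot']
    intro u hu
    refine hQ u fun v => ?_
    rw [show Q u = 0 from hu, zero_apply]
  have hr : Module.finrank ℝ E = Module.finrank ℝ (E →L[ℝ] ℝ) := by
    rw [← (LinearMap.toContinuousLinearMap (𝕜 := ℝ) (E := E) (F' := ℝ)).finrank_eq]
    exact (Subspace.dual_finrank_eq (K := ℝ) (V := E)).symm
  exact ⟨(LinearEquiv.ofInjectiveOfFinrankEq _ hinj hr).toContinuousLinearEquiv, rfl⟩

/-- The differential of the chart at `b`, at the point `z`. -/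
def dChart (b z : M) : E →L[ℝ] E := mfderiv 𝓘(ℝ, E) 𝓘(ℝ, E) (extChartAt 𝓘(ℝ, E) b) z

/-- The differential of the inverse of the chart at `b`, at the point `y`. -/
def dChartInv (E : Type*) [NormedAddCommGroup E] [NormedSpace ℝ E]
    {M : Type*} [TopologicalSpace M] [ChartedSpace E M] (b : M) (y : E) : E →L[ℝ] E :=
  mfderiv 𝓘(ℝ, E) 𝓘(ℝ, E) (extChartAt 𝓘(ℝ, E) b).symm y

theorem dChart_dChartInv {b : M} {y : E} (hy : y ∈ (extChartAt 𝓘(ℝ, E) b).target) (u : E) :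
    dChart b ((extChartAt 𝓘(ℝ, E) b).symm y) (dChartInv E b y u) = u := by
  have := mfderiv_extChartAt_comp_mfderivWithin_extChartAt_symm (I := 𝓘(ℝ, E)) hy
  rw [modelWithCornersSelf_coe, range_id, mfderivWithin_univ] at this
  exact congrArg (fun L : E →L[ℝ] E => L u) this

theorem dChartInv_dChart {b z : M} (hz : z ∈ (extChartAt 𝓘(ℝ, E) b).source) (u : E) :
    dChartInv E b (extChartAt 𝓘(ℝ, E) b z) (dChart b z u) = u := by
  have := mfderivWithin_extChartAt_symm_comp_mfderiv_extChartAt' (I := 𝓘(ℝ, E)) hz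
  rw [modelWithCornersSelf_coe, range_id, mfderivWithin_univ] at this
  exact congrArg (fun L : E →L[ℝ] E => L u) this

theorem dChart_symm_injective {b : M} {z : M} (hz : z ∈ (extChartAt 𝓘(ℝ, E) b).source) :
    Function.Injective (dChart (E := E) b z) :=
  Function.LeftInverse.injective (dChartInv_dChart hz)

/-- A coordinate vector field is constant in the trivialization of the tangent bundle given by the
same chart. -/
theorem contMDiffOn_dChartInv (b : M) (u : E) :
    ContMDiffOn 𝓘(ℝ, E) 𝓘(ℝ, E).tangent ∞ (fun y => Bundle.TotalSpace.mk' E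
      (E := fun z : M => TangentSpace 𝓘(ℝ, E) z) ((extChartAt 𝓘(ℝ, E) b).symm y)
        (dChartInv E b y u)) (extChartAt 𝓘(ℝ, E) b).target := by
  have hs : ∀ y ∈ (extChartAt 𝓘(ℝ, E) b).target,
      (extChartAt 𝓘(ℝ, E) b).symm y ∈ (chartAt E b).source := fun y hy => by
    rw [← extChartAt_source 𝓘(ℝ, E)]
    exact (extChartAt 𝓘(ℝ, E) b).map_target hy
  refine ((trivializationAt E (TangentSpace 𝓘(ℝ, E)) b).contMDiffOn_iff ?_).2 ⟨?_, ?_⟩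
  · intro y hy
    rw [Bundle.Trivialization.mem_source]
    exact hs y hy
  · exact contMDiffOn_extChartAt_symm b
  · refine (contMDiffOn_const (c := u)).congr fun y hy => ?_
    have h1 := TangentBundle.continuousLinearMapAt_trivializationAt (I := 𝓘(ℝ, E)) (hs y hy)
    have h2 := dChart_dChartInv hy u
    rw [dChart, ← h1] at h2
    have h3 := Bundle.Trivialization.continuousLinearMapAt_apply_of_mem ℝ
      (trivializationAt E (TangentSpace 𝓘(ℝ, E)) b) (b := (extChartAt 𝓘(ℝ, E) b).symm y)
      (hs y hy) (dChartInv E b y u)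
    exact h3.symm.trans h2

namespace SemiRiemannianMetric

variable (g : SemiRiemannianMetric E M)

theorem coord_apply' (b : M) (y u v : E) : g.coord b y u v =
    g.inner ((extChartAt 𝓘(ℝ, E) b).symm y) (dChartInv E b y u) (dChartInv E b y v) := rfl

theorem coord_symm (b : M) (y u v : E) : g.coord b y u v = g.coord b y v u := g.symm _ _ _

theorem coord_extChartAt {b z : M} (hz : z ∈ (extChartAt 𝓘(ℝ, E) b).source) (u v : E) :
    g.coord b (extChartAt 𝓘(ℝ, E) b z) (dChart b z u) (dChart b z v) = g.inner z u v := by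
  rw [coord_apply', dChartInv_dChart hz, dChartInv_dChart hz]
  have key : ∀ z' : M, z' = z → ∀ a c : E, g.inner z' a c = g.inner z a c := by
    rintro _ rfl a c; rfl
  exact key _ ((extChartAt 𝓘(ℝ, E) b).left_inv hz) u v

variable [FiniteDimensional ℝ E]

theorem contDiffOn_coord (b : M) :
    ContDiffOn ℝ ∞ (g.coord b) (extChartAt 𝓘(ℝ, E) b).target := by
  refine contDiffOn_clm_apply.2 fun u => contDiffOn_clm_apply.2 fun v => ?_
  have h1 := g.contMDiff.comp_contMDiffOn (contMDiffOn_extChartAt_symm (n := ∞) (I := 𝓘(ℝ, E)) b)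
  have h2 := ContMDiffOn.clm_bundle_apply₂ (F₁ := E) (F₂ := E) (F₃ := ℝ)
    (E₃ := fun _ : M => ℝ) (b := (extChartAt 𝓘(ℝ, E) b).symm)
    (ψ := fun y => g.inner ((extChartAt 𝓘(ℝ, E) b).symm y)) h1 (contMDiffOn_dChartInv b u)
    (contMDiffOn_dChartInv b v)
  intro y hy
  have h3 := h2 y hy
  rw [Bundle.contMDiffWithinAt_totalSpace] at h3
  exact h3.2.contDiffWithinAt

theorem isInvertible_coord {b : M} {y : E} (hy : y ∈ (extChartAt 𝓘(ℝ, E) b).target) :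
    (g.coord b y).IsInvertible := by
  refine isInvertible_of_nondegenerate fun u hu => ?_
  have h1 : dChartInv E b y u = 0 := by
    refine g.nondegenerate ((extChartAt 𝓘(ℝ, E) b).symm y) _ fun w => ?_
    have h2 : dChartInv E b y (dChart b ((extChartAt 𝓘(ℝ, E) b).symm y) w) = w := by
      have := dChartInv_dChart ((extChartAt 𝓘(ℝ, E) b).map_target hy) w
      rwa [(extChartAt 𝓘(ℝ, E) b).right_inv hy] at this
    have h3 := hu (dChart b ((extChartAt 𝓘(ℝ, E) b).symm y) w)
    rw [coord_apply', h2] at h3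
    exact h3
  rw [← dChart_dChartInv hy u, h1, map_zero]

theorem isMetricNear_coord {b : M} {y : E} (hy : y ∈ (extChartAt 𝓘(ℝ, E) b).target) :
    IsMetricNear (g.coord b) y := by
  have hT := (isOpen_extChartAt_target (I := 𝓘(ℝ, E)) b).mem_nhds hy
  refine ⟨?_, Eventually.of_forall fun z u v => g.coord_symm b z u v, ?_⟩
  · filter_upwards [eventually_mem_nhds_iff.2 hT] with z hz
    exact (g.contDiffOn_coord b).contDiffAt hz
  · filter_upwards [hT] with z hz using g.isInvertible_coord hz

end SemiRiemannianMetric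

end MetricInChart

/-! ## The submersion in the cone over the pseudo-hyperbolic space -/

namespace PseudoHyperbolicSpace

set_option maxSynthPendingDepth 3

variable {m s : ℕ}

local notation "𝔼" => EuclideanSpace ℝ (Fin (m + 1))
local notation "𝔽" => EuclideanSpace ℝ (Fin m)

theorem isInvertible_pseudoForm : (pseudoForm m s).IsInvertible :=
  isInvertible_of_nondegenerate pseudoForm_nondegenerate

theorem pseudoForm_inverse_apply (α : 𝔼 →L[ℝ] ℝ) (a : 𝔼) :
    pseudoForm m s ((pseudoForm m s).inverse α) a = α a := by
  obtain ⟨e, he⟩ := isInvertible_pseudoForm (m := m) (s := s)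
  rw [← he, ContinuousLinearMap.inverse_equiv]
  simp

variable {F : Type*} [NormedAddCommGroup F] [NormedSpace ℝ F]
  {B : Type*} [TopologicalSpace B] [ChartedSpace F B]

/-- The differential of a map on `H^m_s`. -/
def dProj (F : Type*) [NormedAddCommGroup F] [NormedSpace ℝ F]
    {B : Type*} [TopologicalSpace B] [ChartedSpace F B]
    (π : PseudoHyperbolicSpace m s → B) (y : PseudoHyperbolicSpace m s) : 𝔽 →L[ℝ] F :=
  mfderiv 𝓘(ℝ, 𝔽) 𝓘(ℝ, F) π y

/-- The map `x ↦ π(x / |x|)` on the cone over `H^m_s`, in the chart of the base at `b`. -/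
def coneMap (F : Type*) [NormedAddCommGroup F] [NormedSpace ℝ F]
    {B : Type*} [TopologicalSpace B] [ChartedSpace F B]
    (π : PseudoHyperbolicSpace m s → B) (p : PseudoHyperbolicSpace m s) (b : B) (x : 𝔼) : F :=
  extChartAt 𝓘(ℝ, F) b (π (ofCone p x))

/-- The domain of `coneMap`. -/
def coneDomain (F : Type*) [NormedAddCommGroup F] [NormedSpace ℝ F]
    {B : Type*} [TopologicalSpace B] [ChartedSpace F B]
    (π : PseudoHyperbolicSpace m s → B) (p : PseudoHyperbolicSpace m s) (b : B) : Set 𝔼 :=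
  {x | pseudoForm m s x x < 0} ∩ (π ∘ ofCone p) ⁻¹' (extChartAt 𝓘(ℝ, F) b).source

variable [IsManifold 𝓘(ℝ, F) ∞ B]

/-- The horizontal lift for `coneMap`. -/
def coneLift (g : SemiRiemannianMetric F B)
    (π : PseudoHyperbolicSpace m s → B) (p : PseudoHyperbolicSpace m s) (b : B) (x : 𝔼) :
    F →L[ℝ] 𝔼 :=
  (-pseudoForm m s x x) • ((pseudoForm m s).inverse ∘L
    (ContinuousLinearMap.precomp ℝ (fderiv ℝ (coneMap F π p b) x)) ∘L
      g.coord b (coneMap F π p b x))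

variable {g : SemiRiemannianMetric F B} {π : PseudoHyperbolicSpace m s → B}
  {p : PseudoHyperbolicSpace m s} {b : B}

omit [IsManifold 𝓘(ℝ, F) ∞ B] in
theorem isOpen_coneDomain (hπ : Continuous π) : IsOpen (coneDomain F π p b) := by
  refine ContinuousOn.isOpen_inter_preimage ?_ isOpen_cone (isOpen_extChartAt_source b)
  exact hπ.comp_continuousOn fun x hx => (contMDiffAt_ofCone p hx).continuousAt.continuousWithinAt

omit [IsManifold 𝓘(ℝ, F) ∞ B] in
theorem coneMap_mem_target {x : 𝔼} (hx : x ∈ coneDomain F π p b) :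
    coneMap F π p b x ∈ (extChartAt 𝓘(ℝ, F) b).target :=
  (extChartAt 𝓘(ℝ, F) b).map_source hx.2

theorem contDiffAt_coneMap (hπ : ContMDiff 𝓘(ℝ, 𝔽) 𝓘(ℝ, F) ∞ π) {x : 𝔼}
    (hx : x ∈ coneDomain F π p b) : ContDiffAt ℝ ∞ (coneMap F π p b) x := by
  have h1 : ContMDiffAt 𝓘(ℝ, F) 𝓘(ℝ, F) ∞ (extChartAt 𝓘(ℝ, F) b) (π (ofCone p x)) := by
    apply contMDiffAt_extChartAt'
    rw [← extChartAt_source 𝓘(ℝ, F)]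
    exact hx.2
  exact (h1.comp x ((hπ _).comp x (contMDiffAt_ofCone p hx.1))).contDiffAt

theorem fderiv_coneMap (hπ : ContMDiff 𝓘(ℝ, 𝔽) 𝓘(ℝ, F) ∞ π) {x : 𝔼}
    (hx : x ∈ coneDomain F π p b) (a : 𝔼) : fderiv ℝ (coneMap F π p b) x a =
      dChart b (π (ofCone p x)) (dProj F π (ofCone p x) (dOfCone p x a)) := by
  have h1 : MDifferentiableAt 𝓘(ℝ, F) 𝓘(ℝ, F) (extChartAt 𝓘(ℝ, F) b) (π (ofCone p x)) := by
    apply mdifferentiableAt_extChartAt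
    rw [← extChartAt_source 𝓘(ℝ, F)]
    exact hx.2
  have h2 := ((hπ (ofCone p x)).mdifferentiableAt (by simp)).hasMFDerivAt
  have h3 := ((contMDiffAt_ofCone p hx.1).mdifferentiableAt (by simp)).hasMFDerivAt
  have h4 : HasFDerivAt (coneMap F π p b) (dChart b (π (ofCone p x)) ∘L
      (dProj F π (ofCone p x) ∘L dOfCone p x)) x :=
    (h1.hasMFDerivAt.comp x (h2.comp x h3)).hasFDerivAt
  rw [h4.fderiv]
  rfl

theorem fderiv_coneMap_self (hπ : ContMDiff 𝓘(ℝ, 𝔽) 𝓘(ℝ, F) ∞ π) {x : 𝔼}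
    (hx : x ∈ coneDomain F π p b) : fderiv ℝ (coneMap F π p b) x x = 0 := by
  rw [fderiv_coneMap hπ hx, dOfCone_self p hx.1, map_zero, map_zero]

theorem fderiv_coneMap_eq_zero_iff (hπ : ContMDiff 𝓘(ℝ, 𝔽) 𝓘(ℝ, F) ∞ π) {x : 𝔼}
    (hx : x ∈ coneDomain F π p b) (a : 𝔼) : fderiv ℝ (coneMap F π p b) x a = 0 ↔
      dProj F π (ofCone p x) (dOfCone p x a) = 0 := by
  rw [fderiv_coneMap hπ hx]
  exact map_eq_zero_iff (dChart b (π (ofCone p x))) (dChart_symm_injective hx.2)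

theorem contDiffAt_coneLift [FiniteDimensional ℝ F] (hπ : ContMDiff 𝓘(ℝ, 𝔽) 𝓘(ℝ, F) ∞ π) {x : 𝔼}
    (hx : x ∈ coneDomain F π p b) : ContDiffAt ℝ ∞ (coneLift g π p b) x := by
  have h1 := contDiffAt_coneMap hπ hx
  have h2 : ContDiffAt ℝ ∞ (fun x => g.coord b (coneMap F π p b x)) x :=
    (g.isMetricNear_coord (coneMap_mem_target hx)).contDiffAt.comp x h1
  have h3 : ContDiffAt ℝ ∞ (fun x => (ContinuousLinearMap.compL ℝ 𝔼 F ℝ).flip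
      (fderiv ℝ (coneMap F π p b) x)) x :=
    ((ContinuousLinearMap.compL ℝ 𝔼 F ℝ).flip).contDiff.contDiffAt.comp x
      h1.contDiffAt_fderiv_infty
  have h4 : ContDiffAt ℝ ∞ (fun x : 𝔼 => -pseudoForm m s x x) x :=
    (((pseudoForm m s).contDiff.clm_apply contDiff_id).neg).contDiffAt
  exact h4.smul (contDiffAt_const.clm_comp (h3.clm_comp h2))

theorem form_coneLift (x a : 𝔼) (u : F) : pseudoForm m s (coneLift g π p b x u) a =
    -pseudoForm m s x x * g.coord b (coneMap F π p b x) u (fderiv ℝ (coneMap F π p b) x a) := by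
  rw [coneLift, smul_apply, map_smul, smul_apply, ContinuousLinearMap.comp_apply,
    pseudoForm_inverse_apply]
  rfl

/-- Horizontal lifts of tangent vectors. -/
theorem exists_horizontal_lift (h : IsSemiRiemannianSubmersion (metric m s) g π)
    (y : PseudoHyperbolicSpace m s) (w : F) : ∃ ξ : 𝔽, dProj F π y ξ = w ∧
      ∀ Y : 𝔽, pseudoForm m s (y.emb ξ) (y.emb Y) = g.inner (π y) w (dProj F π y Y) := by
  let Q : LinearMap.BilinForm ℝ 𝔽 :=
    LinearMap.mk₂ ℝ (fun u v => pseudoForm m s (y.emb u) (y.emb v)) (by simp) (by simp) (by simp)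
      (by simp)
  let W : Submodule ℝ 𝔽 := LinearMap.ker (dProj F π y).toLinearMap
  have hQ (u v : 𝔽) : Q u v = pseudoForm m s (y.emb u) (y.emb v) := rfl
  have hsymm (u v : 𝔽) : Q u v = Q v u := pseudoForm_symm _ _
  have hin (u v : 𝔽) : (metric m s).inner y u v = Q u v := metric_inner y u v
  have hrefl : Q.IsRefl := fun u v huv => by rw [hsymm, huv]
  have hnd : (Q.restrict W).Nondegenerate := by
    have hl : ∀ u : W, (∀ v : W, Q u v = 0) → u = 0 := fun u hu => by
      have h1 : (u : 𝔽) = 0 := h.fibre_nondegenerate y (u : 𝔽) u.2 fun V hV =>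
        (hin u V).trans (hu ⟨V, hV⟩)
      exact Subtype.ext h1
    exact ⟨fun u hu => hl u hu, fun u hu => hl u fun v => (hsymm u v).trans (hu v)⟩
  -- Nondegeneracy of the fibre metric is what splits the tangent space into vertical and horizontal
  -- parts.
  have hcompl := LinearMap.BilinForm.isCompl_orthogonal_of_restrict_nondegenerate hrefl hnd
  have hdec (Y : 𝔽) : ∃ V ∈ W, ∃ X ∈ Q.orthogonal W, V + X = Y :=
    Submodule.mem_sup.1 (hcompl.sup_eq_top ▸ Submodule.mem_top (x := Y))
  have hhor {X : 𝔽} (hX : X ∈ Q.orthogonal W) : IsHorizontal (E' := F) (metric m s) π y X :=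
    fun V hV => (hin X V).trans ((hsymm X V).trans (hX V hV))
  obtain ⟨Y₀, hY₀⟩ := h.surjective_mfderiv y w
  obtain ⟨V₀, hV₀, ξ, hξ, rfl⟩ := hdec Y₀
  have hw : dProj F π y ξ = w := by
    have h1 : dProj F π y (V₀ + ξ) = w := hY₀
    rwa [map_add, show dProj F π y V₀ = 0 from hV₀, zero_add] at h1
  refine ⟨ξ, hw, fun Y => ?_⟩
  obtain ⟨V, hV, X, hX, rfl⟩ := hdec Y
  have h1 := h.inner_mfderiv y ξ X (hhor hξ) (hhor hX)
  have h2 : g.inner (π y) (dProj F π y ξ) (dProj F π y X) = Q ξ X := h1.trans (hin ξ X)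
  have h3 : dProj F π y (V + X) = dProj F π y X := by
    rw [map_add, show dProj F π y V = 0 from hV, zero_add]
  rw [h3, ← hQ, map_add, hsymm ξ V, show Q V ξ = 0 from hξ V hV, zero_add, ← h2, hw]

/-- `coneLift` is defined by raising an index, so this is where the isometry condition on horizontal
vectors is used: it identifies the lift with `√(-⟨x, x⟩)` times the horizontal lift in `H^m_s`. -/
theorem fderiv_coneLift (h : IsSemiRiemannianSubmersion (metric m s) g π) {x : 𝔼}
    (hx : x ∈ coneDomain F π p b) (u : F) :
    fderiv ℝ (coneMap F π p b) x (coneLift g π p b x u) = u := by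
  set y := ofCone p x with hy
  have hr : 0 < -pseudoForm m s x x := neg_pos.2 hx.1
  have hrr := Real.mul_self_sqrt hr.le
  obtain ⟨ξ, hξ, hY⟩ := exists_horizontal_lift h y (dChartInv F b (extChartAt 𝓘(ℝ, F) b (π y)) u)
  have hu : dChart b (π y) (dProj F π y ξ) = u := by
    rw [hξ]
    have key : ∀ z : B, z = π y →
        dChart b z (dChartInv F b (extChartAt 𝓘(ℝ, F) b (π y)) u) = u → dChart b (π y)
        (dChartInv F b (extChartAt 𝓘(ℝ, F) b (π y)) u) = u := by
      rintro _ rfl hz; exact hz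
    exact key _ ((extChartAt 𝓘(ℝ, F) b).left_inv hx.2)
      (dChart_dChartInv (coneMap_mem_target hx) u)
  -- Both vectors have the same pairing with every `a`, split into tangent and radial parts. The
  -- zero radial term fits `dOfCone_smul_emb`.
  have hL : coneLift g π p b x u = √(-pseudoForm m s x x) • y.emb ξ + (0 : ℝ) • x := by
    rw [zero_smul, add_zero, ← sub_eq_zero]
    refine pseudoForm_nondegenerate (s := s) _ fun a => ?_
    obtain ⟨c, hc⟩ := exists_eq_emb_add p hx.1 a
    have h1 : pseudoForm m s (y.emb ξ) a =
        √(-pseudoForm m s x x) * g.coord b (coneMap F π p b x) u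
          (fderiv ℝ (coneMap F π p b) x a) := by
      conv_lhs => rw [hc]
      rw [map_add, map_smul, map_smul, form_emb_self p hx.1, smul_zero, add_zero, ← hy, hY, ← hξ,
        fderiv_coneMap h.contMDiff hx, ← hy, ← hu, smul_eq_mul]
      congr 1
      exact (g.coord_extChartAt (b := b) (z := π y) hx.2 _ _).symm
    rw [map_sub, sub_apply, form_coneLift, map_smul, smul_apply, h1, smul_eq_mul, ← mul_assoc, hrr,
      sub_self]
  rw [fderiv_coneMap h.contMDiff hx, hL, dOfCone_smul_emb p hx.1, ← hy, hu]

end PseudoHyperbolicSpace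

/-! ### Totally geodesic fibres and the Hessian of the cone map -/

namespace PseudoHyperbolicSpace

set_option maxSynthPendingDepth 3

variable {m s : ℕ}

local notation "𝔼" => EuclideanSpace ℝ (Fin (m + 1))
local notation "𝔽" => EuclideanSpace ℝ (Fin m)

theorem sqrt_form_smul_incl (y : PseudoHyperbolicSpace m s) {r : ℝ} (hr : 0 < r) :
    √(-pseudoForm m s (r • y.incl) (r • y.incl)) = r := by
  simp only [map_smul, smul_apply, smul_eq_mul, y.pseudoForm_incl, mul_neg, mul_one, neg_neg,
    Real.sqrt_mul_self hr.le]

theorem dOfCone_smul_incl (p y : PseudoHyperbolicSpace m s) {r : ℝ} (hr : 0 < r) (v : 𝔽) :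
    dOfCone p (r • y.incl) (r • y.emb v) = v := by
  have := dOfCone_smul_emb p (y.pseudoForm_smul_incl_neg hr) v 0
  rwa [zero_smul, add_zero, sqrt_form_smul_incl y hr, ofCone_smul_incl p y hr] at this

theorem dOfCone_incl (p y : PseudoHyperbolicSpace m s) (v : 𝔽) :
    dOfCone p y.incl (y.emb v) = v := by
  simpa using dOfCone_smul_incl p y one_pos v

theorem dChart_self (y : PseudoHyperbolicSpace m s) :
    dChart (E := 𝔽) y y = ContinuousLinearMap.id ℝ 𝔽 := by
  ext1 u
  have h1 := dChartInv_dChart (E := 𝔽) (mem_extChartAt_source (I := 𝓘(ℝ, 𝔽)) y) u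
  rw [extChartAt_self] at h1
  rwa [show dChartInv 𝔽 y 0 = ContinuousLinearMap.id ℝ 𝔽 from y.dChartSymm_zero] at h1

/-- The covariant derivative at the centre of a chart is the derivative in that chart. -/
theorem covariantDeriv_metric (y : PseudoHyperbolicSpace m s)
    (V : Π z : PseudoHyperbolicSpace m s, TangentSpace 𝓘(ℝ, 𝔽) z) (u : 𝔽) :
    (metric m s).covariantDeriv V y u =
      (fderiv ℝ (fun w : 𝔽 => dChart y ((extChartAt 𝓘(ℝ, 𝔽) y).symm w)
        (V ((extChartAt 𝓘(ℝ, 𝔽) y).symm w))) 0 u : 𝔽) := by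
  have h : (metric m s).covariantDeriv V y u = (dChart (E := 𝔽) y y).inverse
      (fderiv ℝ (fun w : 𝔽 => dChart y ((extChartAt 𝓘(ℝ, 𝔽) y).symm w)
        (V ((extChartAt 𝓘(ℝ, 𝔽) y).symm w))) (extChartAt 𝓘(ℝ, 𝔽) y y) (dChart y y u) +
        christoffel ((metric m s).coord y) (extChartAt 𝓘(ℝ, 𝔽) y y) (dChart y y u)
          (dChart y ((extChartAt 𝓘(ℝ, 𝔽) y).symm (extChartAt 𝓘(ℝ, 𝔽) y y))
        (V ((extChartAt 𝓘(ℝ, 𝔽) y).symm (extChartAt 𝓘(ℝ, 𝔽) y y))))) := rfl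
  rw [h, extChartAt_self, christoffel_coord_metric_zero, dChart_self, add_zero,
    ContinuousLinearMap.inverse_id]
  rfl

variable {F : Type*} [NormedAddCommGroup F] [NormedSpace ℝ F] [FiniteDimensional ℝ F]
  {B : Type*} [TopologicalSpace B] [ChartedSpace F B] [IsManifold 𝓘(ℝ, F) ∞ B]
  {g : SemiRiemannianMetric F B} {π : PseudoHyperbolicSpace m s → B}
  {p : PseudoHyperbolicSpace m s} {b : B}

omit [FiniteDimensional ℝ F] [IsManifold 𝓘(ℝ, F) ∞ B] in
theorem smul_incl_mem_coneDomain {y : PseudoHyperbolicSpace m s}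
    (hy : π y ∈ (extChartAt 𝓘(ℝ, F) b).source) {r : ℝ} (hr : 0 < r) :
    r • y.incl ∈ coneDomain F π p b := by
  refine ⟨y.pseudoForm_smul_incl_neg hr, ?_⟩
  rw [mem_preimage, Function.comp_apply, ofCone_smul_incl p y hr]
  exact hy

omit [FiniteDimensional ℝ F] [IsManifold 𝓘(ℝ, F) ∞ B] in
theorem incl_mem_coneDomain {y : PseudoHyperbolicSpace m s}
    (hy : π y ∈ (extChartAt 𝓘(ℝ, F) b).source) : y.incl ∈ coneDomain F π p b := by
  simpa using smul_incl_mem_coneDomain (p := p) hy one_pos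

omit [FiniteDimensional ℝ F] in
theorem fderiv_coneMap_smul_incl (hπ : ContMDiff 𝓘(ℝ, 𝔽) 𝓘(ℝ, F) ∞ π)
    {y : PseudoHyperbolicSpace m s} (hy : π y ∈ (extChartAt 𝓘(ℝ, F) b).source) {r : ℝ}
    (hr : 0 < r) (v : 𝔽) :
    fderiv ℝ (coneMap F π p b) (r • y.incl) (r • y.emb v) = dChart b (π y) (dProj F π y v) := by
  rw [fderiv_coneMap hπ (smul_incl_mem_coneDomain hy hr), dOfCone_smul_incl p y hr,
    ofCone_smul_incl p y hr]

/-- The radial projection in the chart at `y`. -/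
def coneChart (p y : PseudoHyperbolicSpace m s) (x : 𝔼) : 𝔽 :=
  extChartAt 𝓘(ℝ, 𝔽) y (ofCone p x)

theorem hasFDerivAt_coneChart (p y z : PseudoHyperbolicSpace m s)
    (hz : z ∈ (extChartAt 𝓘(ℝ, 𝔽) y).source) :
    HasFDerivAt (coneChart p y) (dChart y z ∘L dOfCone p z.incl) z.incl := by
  have h1 : MDifferentiableAt 𝓘(ℝ, 𝔽) 𝓘(ℝ, 𝔽) (extChartAt 𝓘(ℝ, 𝔽) y) (ofCone p z.incl) := by
    apply mdifferentiableAt_extChartAt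
    rw [← extChartAt_source 𝓘(ℝ, 𝔽), ofCone_incl]
    exact hz
  have h2 : HasFDerivAt (coneChart p y) (dChart y (ofCone p z.incl) ∘L dOfCone p z.incl) z.incl :=
    (h1.hasMFDerivAt.comp z.incl ((contMDiffAt_ofCone p z.pseudoForm_incl_neg).mdifferentiableAt
      (by simp)).hasMFDerivAt).hasFDerivAt
  rwa [ofCone_incl] at h2

theorem contDiffAt_coneChart (p y : PseudoHyperbolicSpace m s) :
    ContDiffAt ℝ ∞ (coneChart p y) y.incl := by
  have h1 : ContMDiffAt 𝓘(ℝ, 𝔽) 𝓘(ℝ, 𝔽) ∞ (extChartAt 𝓘(ℝ, 𝔽) y) (ofCone p y.incl) := by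
    rw [ofCone_incl]
    exact contMDiffAt_extChartAt
  exact (h1.comp y.incl (contMDiffAt_ofCone p y.pseudoForm_incl_neg)).contDiffAt

/-- The tangential part of a smooth vector field on `ℝ^{m+1}` is a smooth vector field. -/
theorem contMDiffAt_dOfCone (p y : PseudoHyperbolicSpace m s) {Z : 𝔼 → 𝔼}
    (hZ : ContDiffAt ℝ ∞ Z y.incl) :
    ContMDiffAt 𝓘(ℝ, 𝔽) 𝓘(ℝ, 𝔽).tangent ∞ (fun z : PseudoHyperbolicSpace m s =>
      (⟨z, dOfCone p z.incl (Z z.incl)⟩ : TangentBundle 𝓘(ℝ, 𝔽) (PseudoHyperbolicSpace m s))) y := by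
  have h1 : ContDiffAt ℝ ∞ (fun x => fderiv ℝ (coneChart p y) x (Z x)) y.incl :=
    (contDiffAt_coneChart p y).contDiffAt_fderiv_infty.clm_apply hZ
  refine (Bundle.contMDiffAt_section (E := TangentSpace 𝓘(ℝ, 𝔽))
    (s := fun z : PseudoHyperbolicSpace m s => dOfCone p z.incl (Z z.incl)) y).2 ?_
  refine (h1.contMDiffAt.comp y (contMDiff_incl y)).congr_of_eventuallyEq ?_
  filter_upwards [chart_source_mem_nhds 𝔽 y] with z hz
  have h2 := TangentBundle.continuousLinearMapAt_trivializationAt (I := 𝓘(ℝ, 𝔽)) hz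
  have h3 := Bundle.Trivialization.continuousLinearMapAt_apply_of_mem ℝ
    (trivializationAt 𝔽 (TangentSpace 𝓘(ℝ, 𝔽)) y) (b := z) hz (dOfCone p z.incl (Z z.incl))
  refine h3.symm.trans ?_
  rw [h2, Function.comp_apply, (hasFDerivAt_coneChart p y z (by rwa [extChartAt_source])).fderiv]
  rfl

/-- Extend `v` to a vertical field `V`, and let `W` be its expression in the chart at `y`.
Differentiating `df (dgraph (W)) = 0` at the centre along `u` yields `D²f(u, v)` and two further
terms. One involves `D²graph(u, v)`, which is radial and so killed by `df`; the other involves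
`DW(u) = ∇_u V`, which is vertical because the fibres are totally geodesic. The scale `r` reaches
the points of the cone off the quadric. -/
theorem hessian_coneMap_emb (h : IsSemiRiemannianSubmersion (metric m s) g π)
    (hgeo : HasTotallyGeodesicFibres F (metric m s) π) {y : PseudoHyperbolicSpace m s}
    (hy : π y ∈ (extChartAt 𝓘(ℝ, F) b).source) {r : ℝ} (hr : 0 < r) {u v : 𝔽}
    (hu : dProj F π y u = 0) (hv : dProj F π y v = 0) :
    fderiv ℝ (fderiv ℝ (coneMap F π p b)) (r • y.incl) (r • y.emb u) (r • y.emb v) = 0 := by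
  set f := coneMap F π p b with hf
  have hπ := h.contMDiff
  have hxU : r • y.incl ∈ coneDomain F π p b := smul_incl_mem_coneDomain hy hr
  have hyU : y.incl ∈ coneDomain F π p b := incl_mem_coneDomain hy
  -- The vertical projection of the constant field `emb v`; its tangential part is the required
  -- smooth vertical field on `H^m_s`.
  let Z : 𝔼 → 𝔼 := fun x => y.emb v - coneLift g π p b x (fderiv ℝ f x (y.emb v))
  have hZ : ContDiffAt ℝ ∞ Z y.incl := contDiffAt_const.sub ((contDiffAt_coneLift hπ hyU).clm_apply
    ((contDiffAt_coneMap hπ hyU).contDiffAt_fderiv_infty.clm_apply contDiffAt_const))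
  let V : PseudoHyperbolicSpace m s → 𝔽 := fun z => dOfCone p z.incl (Z z.incl)
  have hsrc : ∀ᶠ z in 𝓝 y, π z ∈ (extChartAt 𝓘(ℝ, F) b).source :=
    hπ.continuous.continuousAt.eventually_mem ((isOpen_extChartAt_source b).mem_nhds hy)
  have hVvert : ∀ z : PseudoHyperbolicSpace m s, π z ∈ (extChartAt 𝓘(ℝ, F) b).source →
      dProj F π z (V z) = 0 := fun z hz => by
    have hzU : z.incl ∈ coneDomain F π p b := incl_mem_coneDomain hz
    have := (fderiv_coneMap_eq_zero_iff hπ hzU (Z z.incl)).1 (by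
      rw [map_sub, fderiv_coneLift h hzU, sub_self])
    rwa [ofCone_incl] at this
  have hVy : V y = v := by
    have h1 : fderiv ℝ f y.incl (y.emb v) = 0 := by
      rw [fderiv_coneMap hπ hyU, dOfCone_incl, ofCone_incl, hv, map_zero]
    change dOfCone p y.incl (y.emb v - coneLift g π p b y.incl (fderiv ℝ f y.incl (y.emb v))) = v
    rw [h1, map_zero, sub_zero, dOfCone_incl]
  let W : 𝔽 → 𝔽 := fun w => dChart y ((extChartAt 𝓘(ℝ, 𝔽) y).symm w)
    (V ((extChartAt 𝓘(ℝ, 𝔽) y).symm w))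
  have hcov : dProj F π y (fderiv ℝ W 0 u) = 0 := by
    have h1 : dProj F π y ((metric m s).covariantDeriv V y u) = 0 :=
      hgeo y V (contMDiffAt_dOfCone p y hZ) (hsrc.mono hVvert) u hu
    exact (congrArg (dProj F π y) (covariantDeriv_metric y V u)).symm.trans h1
  have ht := y.mem_chart_target_zero
  have htn := y.chart.open_target.mem_nhds ht
  have hWd : DifferentiableAt ℝ W 0 := by
    have h1 : ContDiffAt ℝ ∞ (fun w => fderiv ℝ (coneChart p y) (y.graph w) (Z (y.graph w))) 0 := by
      have h2 : ContDiffAt ℝ ∞ (fun x => fderiv ℝ (coneChart p y) x (Z x)) (y.graph 0) := by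
        rw [graph_zero]
        exact (contDiffAt_coneChart p y).contDiffAt_fderiv_infty.clm_apply hZ
      exact h2.comp 0 (y.contDiffAt_graph ht)
    refine (h1.differentiableAt (by simp)).congr_of_eventuallyEq ?_
    filter_upwards [htn] with w hw
    rw [← y.extChartAt_symm_incl hw, (hasFDerivAt_coneChart p y _
      ((extChartAt 𝓘(ℝ, 𝔽) y).map_target (by rwa [extChartAt_target_eq]))).fderiv]
    rfl
  have hW0 : W 0 = v := by
    change dChart y ((extChartAt 𝓘(ℝ, 𝔽) y).symm 0) (V ((extChartAt 𝓘(ℝ, 𝔽) y).symm 0)) = v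
    rw [extChartAt_symm_zero, hVy, dChart_self]
    rfl
  have hzero : ∀ᶠ w in 𝓝 (0 : 𝔽),
      fderiv ℝ f (r • y.graph w) (r • fderiv ℝ y.graph w (W w)) = 0 := by
    have hc : ContinuousAt (extChartAt 𝓘(ℝ, 𝔽) y).symm (0 : 𝔽) :=
      (y.mdifferentiableAt_extChartAt_symm ht).continuousAt
    have hsrc' : ∀ᶠ z in 𝓝 ((extChartAt 𝓘(ℝ, 𝔽) y).symm 0),
        π z ∈ (extChartAt 𝓘(ℝ, F) b).source := by rwa [extChartAt_symm_zero]
    filter_upwards [htn, hc.eventually hsrc'] with w hw hw'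
    have h1 := dChartInv_dChart (E := 𝔽) (b := y) (z := (extChartAt 𝓘(ℝ, 𝔽) y).symm w)
      ((extChartAt 𝓘(ℝ, 𝔽) y).map_target (by rwa [extChartAt_target_eq]))
      (V ((extChartAt 𝓘(ℝ, 𝔽) y).symm w))
    rw [(extChartAt 𝓘(ℝ, 𝔽) y).right_inv (by rwa [extChartAt_target_eq])] at h1
    have h2 : y.dChartSymm w (W w) = V ((extChartAt 𝓘(ℝ, 𝔽) y).symm w) := h1
    rw [← y.emb_dChartSymm hw, ← y.extChartAt_symm_incl hw, h2,
      fderiv_coneMap_smul_incl hπ hw' hr, hVvert _ hw', map_zero]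
  have hg := y.contDiffAt_graph ht
  have hf2 : HasFDerivAt (fderiv ℝ f) (fderiv ℝ (fderiv ℝ f) (r • y.incl)) (r • y.graph 0) := by
    rw [graph_zero]
    exact (contDiffAt_coneMap hπ hxU).contDiffAt_fderiv_infty.hasFDerivAt_infty
  have h1 := (hf2.comp 0 (hg.hasFDerivAt_infty.const_smul r)).clm_apply
    ((hg.contDiffAt_fderiv_infty.hasFDerivAt_infty.clm_apply hWd.hasFDerivAt).const_smul r)
  have h2 := h1.unique_of_eventuallyEq (hasFDerivAt_const (0 : F) 0) hzero u
  have h3 : fderiv ℝ f (r • y.incl) (r • y.incl) = 0 := fderiv_coneMap_self hπ hxU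
  have h4 : fderiv ℝ f (r • y.incl) (r • y.emb (fderiv ℝ W 0 u)) = 0 := by
    rw [fderiv_coneMap_smul_incl hπ hy hr, hcov, map_zero]
  rw [map_smul] at h3 h4
  have h5 := (smul_eq_zero.1 h3).resolve_left hr.ne'
  have h6 := (smul_eq_zero.1 h4).resolve_left hr.ne'
  simp [fderiv_graph_zero, fderiv_fderiv_graph_zero, graph_zero, hW0, h5, h6] at h2
  simpa using h2

/-- Radial components are harmless, because `D²f(a, x) = -df a = 0` for vertical `a`; the tangential
components are covered by `hessian_coneMap_emb`. -/
theorem hessian_coneMap (h : IsSemiRiemannianSubmersion (metric m s) g π)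
    (hgeo : HasTotallyGeodesicFibres F (metric m s) π) {x : 𝔼} (hx : x ∈ coneDomain F π p b)
    {V W : 𝔼} (hV : fderiv ℝ (coneMap F π p b) x V = 0)
    (hW : fderiv ℝ (coneMap F π p b) x W = 0) :
    fderiv ℝ (fderiv ℝ (coneMap F π p b)) x V W = 0 := by
  have hπ := h.contMDiff
  have hr := Real.sqrt_pos.2 (neg_pos.2 hx.1)
  have hcd := contDiffAt_coneMap hπ hx
  have hself (a : 𝔼) (ha : fderiv ℝ (coneMap F π p b) x a = 0) :
      fderiv ℝ (fderiv ℝ (coneMap F π p b)) x a x = 0 := by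
    have := (hcd.contDiffAt_fderiv_infty.hasFDerivAt_infty.clm_apply
      (hasFDerivAt_id x)).unique_of_eventuallyEq (hasFDerivAt_const (0 : F) x)
      (by
        filter_upwards [(isOpen_coneDomain hπ.continuous).mem_nhds hx] with z hz
        exact fderiv_coneMap_self hπ hz) a
    simp only [add_apply, ContinuousLinearMap.comp_apply, ContinuousLinearMap.flip_apply,
      ContinuousLinearMap.id_apply, zero_apply, id, ha, zero_add] at this
    exact this
  obtain ⟨c, hc⟩ := exists_eq_emb_add p hx.1 V
  obtain ⟨d, hd⟩ := exists_eq_emb_add p hx.1 W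
  have key := hessian_coneMap_emb (p := p) h hgeo (y := ofCone p x) hx.2 hr
    ((fderiv_coneMap_eq_zero_iff hπ hx V).1 hV) ((fderiv_coneMap_eq_zero_iff hπ hx W).1 hW)
  rw [smul_incl_ofCone p hx.1] at key
  have expand (V' W' : 𝔼) (hc : V = V' + c • x) (hd : W = W' + d • x)
      (key : fderiv ℝ (fderiv ℝ (coneMap F π p b)) x V' W' = 0) :
      fderiv ℝ (fderiv ℝ (coneMap F π p b)) x V W = 0 := by
    have hW' : fderiv ℝ (coneMap F π p b) x W' = 0 := by
      rw [eq_sub_of_add_eq hd.symm, map_sub, map_smul, fderiv_coneMap_self hπ hx, hW, smul_zero,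
        sub_zero]
    have h1 : fderiv ℝ (fderiv ℝ (coneMap F π p b)) x V W =
        fderiv ℝ (fderiv ℝ (coneMap F π p b)) x V W' := by
      rw [hd, map_add, map_smul, hself V hV, smul_zero, add_zero]
    rw [h1, hcd.fderiv_fderiv_comm, hc, map_add, map_smul, hself W' hW', smul_zero, add_zero,
      hcd.fderiv_fderiv_comm, key]
  exact expand _ _ hc hd key

theorem isConicSubmersion (h : IsSemiRiemannianSubmersion (metric m s) g π)
    (hpos : ∀ (z : B) (v : F), v ≠ 0 → 0 < g.inner z v v)
    (hgeo : HasTotallyGeodesicFibres F (metric m s) π) (p : PseudoHyperbolicSpace m s) (b : B) :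
    IsConicSubmersion (pseudoForm m s) (coneDomain F π p b) (coneMap F π p b) (g.coord b)
      (coneLift g π p b) where
  isOpen := isOpen_coneDomain h.contMDiff.continuous
  contDiffOn x hx := (contDiffAt_coneMap h.contMDiff hx).contDiffWithinAt
  contDiffOn_lift x hx := (contDiffAt_coneLift h.contMDiff hx).contDiffWithinAt
  isMetricNear x hx := g.isMetricNear_coord (coneMap_mem_target hx)
  symm := pseudoForm_symm
  pos_metric x hx u hu := by
    rw [g.coord_apply']
    refine hpos _ _ fun h0 => hu ?_
    rw [← dChart_dChartInv (coneMap_mem_target hx) u, h0, map_zero]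
  lift_form x _ u a := form_coneLift x a u
  fderiv_lift x hx u := fderiv_coneLift h hx u
  fderiv_self x hx := fderiv_coneMap_self h.contMDiff hx
  hessian x hx V W hV hW := hessian_coneMap h hgeo hx hV hW

end PseudoHyperbolicSpace

/-! ## Dimensions and the main theorem -/

namespace PseudoHyperbolicSpace

variable {m s : ℕ}

local notation "𝔼" => EuclideanSpace ℝ (Fin (m + 1))
local notation "𝔽" => EuclideanSpace ℝ (Fin m)

instance : Nonempty (PseudoHyperbolicSpace m s) :=
  ⟨mk (EuclideanSpace.single 0 1) (by
    rw [pseudoForm_apply, Finset.sum_eq_single 0] <;> simp +contextual)⟩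

theorem card_negative (hsm : s ≤ m) : Fintype.card {i : Fin (m + 1) // (i : ℕ) ≤ s} = s + 1 := by
  rw [Fintype.card_subtype]
  have : (Finset.univ.filter fun i : Fin (m + 1) => (i : ℕ) ≤ s) =
      Finset.Iic (⟨s, by omega⟩ : Fin (m + 1)) := by
    ext i
    simp [Fin.le_def]
  rw [this, Fin.card_Iic]

theorem form_nonneg {x : 𝔼} (hx : ∀ i : Fin (m + 1), (i : ℕ) ≤ s → x i = 0) :
    0 ≤ pseudoForm m s x x := by
  rw [pseudoForm_apply]
  refine Finset.sum_nonneg fun i _ => ?_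
  split_ifs with hi
  · simp [hx i hi]
  · rw [one_mul]
    exact mul_self_nonneg _

theorem form_nonpos {x : 𝔼} (hx : ∀ i : Fin (m + 1), ¬(i : ℕ) ≤ s → x i = 0) :
    pseudoForm m s x x ≤ 0 := by
  rw [pseudoForm_apply]
  refine Finset.sum_nonpos fun i _ => ?_
  split_ifs with hi
  · nlinarith [mul_self_nonneg (x i)]
  · simp [hx i hi]

/-- A space on which `⟨·, ·⟩` is negative definite has dimension at most `s + 1`. -/
theorem finrank_le_of_negative (hsm : s ≤ m) {X : Type*} [AddCommGroup X] [Module ℝ X]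
    (T : X →ₗ[ℝ] 𝔼) (hT : ∀ x, x ≠ 0 → pseudoForm m s (T x) (T x) < 0) :
    Module.finrank ℝ X ≤ s + 1 := by
  let R : X →ₗ[ℝ] ({i : Fin (m + 1) // (i : ℕ) ≤ s} → ℝ) :=
    LinearMap.pi fun i => (EuclideanSpace.proj (𝕜 := ℝ) (i : Fin (m + 1))).toLinearMap ∘ₗ T
  -- A vector whose first `s + 1` coordinates vanish has nonnegative form.
  have hR : Function.Injective R := by
    rw [← LinearMap.ker_eq_bot, LinearMap.ker_eq_bot']
    intro x hx
    by_contra h0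
    exact (hT x h0).not_ge (form_nonneg fun i hi => congrFun hx ⟨i, hi⟩)
  simpa [card_negative hsm] using LinearMap.finrank_le_finrank_of_injective hR

/-- A space on which `⟨·, ·⟩` is positive definite has dimension at most `m - s`. -/
theorem finrank_add_le_of_positive (hsm : s ≤ m) {X : Type*} [AddCommGroup X] [Module ℝ X]
    (T : X →ₗ[ℝ] 𝔼) (hT : ∀ x, x ≠ 0 → 0 < pseudoForm m s (T x) (T x)) :
    Module.finrank ℝ X + s ≤ m := by
  let R : X →ₗ[ℝ] ({i : Fin (m + 1) // ¬(i : ℕ) ≤ s} → ℝ) :=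
    LinearMap.pi fun i => (EuclideanSpace.proj (𝕜 := ℝ) (i : Fin (m + 1))).toLinearMap ∘ₗ T
  have hR : Function.Injective R := by
    rw [← LinearMap.ker_eq_bot, LinearMap.ker_eq_bot']
    intro x hx
    by_contra h0
    exact (hT x h0).not_ge (form_nonpos fun i hi => congrFun hx ⟨i, hi⟩)
  have h1 := LinearMap.finrank_le_finrank_of_injective hR
  rw [Module.finrank_fintype_fun_eq_card, Fintype.card_subtype_compl, card_negative hsm,
    Fintype.card_fin] at h1
  omega

variable {F : Type*} [NormedAddCommGroup F] [NormedSpace ℝ F] [FiniteDimensional ℝ F]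
  {B : Type*} [TopologicalSpace B] [ChartedSpace F B] [IsManifold 𝓘(ℝ, F) ∞ B]
  {g : SemiRiemannianMetric F B} {π : PseudoHyperbolicSpace m s → B}
  (h : IsSemiRiemannianSubmersion (metric m s) g π)
  (hpos : ∀ (z : B) (v : F), v ≠ 0 → 0 < g.inner z v v)
  (hgeo : HasTotallyGeodesicFibres F (metric m s) π)

include h hpos hgeo

theorem form_emb_nonpos [Nontrivial F] (p : PseudoHyperbolicSpace m s) {v : 𝔽}
    (hv : dProj F π p v = 0) : pseudoForm m s (p.emb v) (p.emb v) ≤ 0 := by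
  have hp : p.incl ∈ coneDomain F π p (π p) := incl_mem_coneDomain (mem_extChartAt_source _)
  refine (isConicSubmersion h hpos hgeo p (π p)).form_vertical_nonpos hp ?_ p.pseudoForm_incl
    (p.pseudoForm_emb v)
  rw [fderiv_coneMap h.contMDiff hp, dOfCone_incl, ofCone_incl, hv, map_zero]

/-- A null vector of a semidefinite form lies in its radical, and the radical of the fibre metric is
zero. -/
theorem form_emb_neg [Nontrivial F] (p : PseudoHyperbolicSpace m s) {v : 𝔽}
    (hv : dProj F π p v = 0) (hv0 : v ≠ 0) : pseudoForm m s (p.emb v) (p.emb v) < 0 := by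
  refine lt_of_le_of_ne (form_emb_nonpos h hpos hgeo p hv) fun h0 => hv0 ?_
  refine h.fibre_nondegenerate p v hv fun (w : 𝔽) hw => ?_
  refine (metric_inner p v w).trans ?_
  have hw' : dProj F π p w = 0 := hw
  set c := pseudoForm m s (p.emb v) (p.emb w) with hc
  set d := pseudoForm m s (p.emb w) (p.emb w) with hd
  have h1 (t : ℝ) : 2 * t * c + t ^ 2 * d ≤ 0 := by
    have := form_emb_nonpos h hpos hgeo p (v := v + t • w)
      (by rw [map_add, map_smul, hv, hw', smul_zero, add_zero])
    simp only [map_add, map_smul, add_apply, smul_apply, smul_eq_mul, h0,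
      pseudoForm_symm (p.emb w) (p.emb v), ← hc, ← hd] at this
    linarith
  have hd0 : d ≤ 0 := form_emb_nonpos h hpos hgeo p hw'
  by_contra hc0
  -- Any small `t` with the sign of `c` makes the expression positive; dividing by `1 - d ≥ 1`
  -- rather than by `-d` also covers `d = 0`.
  have h2 := h1 (c / (1 - d))
  have h3 : 0 < 1 - d := by linarith
  have h4 : 2 * (c / (1 - d)) * c + (c / (1 - d)) ^ 2 * d = c ^ 2 * (2 - d) / (1 - d) ^ 2 := by
    field_simp
    ring
  rw [h4] at h2
  have : 0 < c ^ 2 * (2 - d) / (1 - d) ^ 2 := by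
    have : 0 < 2 - d := by linarith
    positivity
  linarith

/-- Both bounds from the signature of `q` are needed: the horizontal space gives `n + s ≤ m`, and
`ker df`, of dimension `m + 1 - n`, gives the converse inequality. -/
theorem finrank_add_eq [Nontrivial F] (hsm : s ≤ m) : m = Module.finrank ℝ F + s := by
  obtain ⟨p⟩ := (inferInstance : Nonempty (PseudoHyperbolicSpace m s))
  have hp : p.incl ∈ coneDomain F π p (π p) := incl_mem_coneDomain (mem_extChartAt_source _)
  have hc := isConicSubmersion h hpos hgeo p (π p)
  set f := coneMap F π p (π p)
  set L := coneLift g π p (π p)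
  have h1 := finrank_add_le_of_positive hsm (L p.incl).toLinearMap fun u hu => by
    have := hc.form_lift_lift hp p.pseudoForm_incl u u
    exact this.symm ▸ hc.pos_metric _ hp u hu
  have h2 := finrank_le_of_negative hsm (LinearMap.ker (fderiv ℝ f p.incl).toLinearMap).subtype
    fun a ha => by
      obtain ⟨c, hca⟩ := exists_eq_emb_add p p.pseudoForm_incl_neg (a : 𝔼)
      rw [p.pseudoForm_incl, neg_neg, Real.sqrt_one, one_smul, ofCone_incl] at hca
      have hv := (fderiv_coneMap_eq_zero_iff h.contMDiff hp (a : 𝔼)).1 a.2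
      rw [ofCone_incl] at hv
      set v := dOfCone p p.incl (a : 𝔼)
      -- The radial component adds one negative direction to those of the fibre, which matches the
      -- bound `s + 1`.
      have h3 : pseudoForm m s (a : 𝔼) (a : 𝔼) = pseudoForm m s (p.emb v) (p.emb v) - c ^ 2 := by
        rw [hca]
        simp only [map_add, map_smul, add_apply, smul_apply, smul_eq_mul, p.pseudoForm_emb,
          pseudoForm_symm (p.emb v) p.incl, p.pseudoForm_incl]
        ring
      rw [Submodule.subtype_apply, h3]
      by_cases hv0 : v = 0
      · have hc0 : c ≠ 0 := by
          rintro rfl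
          rw [hv0, map_zero, zero_smul, add_zero] at hca
          exact ha (Subtype.ext hca)
        rw [hv0, map_zero, map_zero]
        have := pow_pos (abs_pos.2 hc0) 2
        rw [sq_abs] at this
        linarith
      · have := form_emb_neg h hpos hgeo p hv hv0
        nlinarith [sq_nonneg c]
  have h3 := LinearMap.finrank_range_add_finrank_ker (fderiv ℝ f p.incl).toLinearMap
  have h4 : LinearMap.range (fderiv ℝ f p.incl).toLinearMap = ⊤ :=
    LinearMap.range_eq_top.2 fun u => ⟨L p.incl u, hc.fderiv_lift _ hp u⟩
  rw [h4, finrank_top, finrank_euclideanSpace, Fintype.card_fin] at h3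
  omega

theorem sectionalCurvature_neg {b : B} {u v : F} (huv : LinearIndependent ℝ ![u, v]) :
    g.sectionalCurvature b u v < 0 := by
  obtain ⟨p, rfl⟩ := h.surjective b
  have hp : p.incl ∈ coneDomain F π p (π p) := incl_mem_coneDomain (mem_extChartAt_source _)
  have hinj := dChart_symm_injective (E := F) (mem_extChartAt_source (I := 𝓘(ℝ, F)) (π p))
  have h1 : LinearIndependent ℝ ![dChart (π p) (π p) u, dChart (π p) (π p) v] := by
    have := huv.map' (dChart (π p) (π p)).toLinearMap (LinearMap.ker_eq_bot.2 hinj)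
    have e : ![dChart (π p) (π p) u, dChart (π p) (π p) v] =
        (dChart (π p) (π p)).toLinearMap ∘ ![u, v] := by
      ext i
      fin_cases i <;> rfl
    rw [e]
    exact this
  have := FiniteDimensional.complete ℝ F
  have h2 := (isConicSubmersion h hpos hgeo p (π p)).coordSectionalCurvature_neg hp
    p.pseudoForm_incl h1
  rw [coneMap, ofCone_incl] at h2
  exact h2

end PseudoHyperbolicSpace

end
theorem mainTheorem6 {m s n : ℕ} (hs : 0 < s) (hsm : s ≤ m) (hn : 0 < n)
    {B : Type*} [TopologicalSpace B] [ChartedSpace (EuclideanSpace ℝ (Fin n)) B]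
    [IsManifold (𝓡 n) ∞ B]
    (gB : Bundle.ContMDiffRiemannianMetric (𝓡 n) ∞ (EuclideanSpace ℝ (Fin n))
      (fun b : B => TangentSpace (𝓡 n) b))
    (π : PseudoHyperbolicSpace m s → B)
    (hπ : IsSemiRiemannianSubmersion (PseudoHyperbolicSpace.metric m s)
      (SemiRiemannianMetric.ofRiemannian gB) π)
    (hgeo : HasTotallyGeodesicFibres (EuclideanSpace ℝ (Fin n))
      (PseudoHyperbolicSpace.metric m s) π) :
    m = n + s ∧
    (∀ (p : PseudoHyperbolicSpace m s),
      ∀ V ∈ verticalSpace (EuclideanSpace ℝ (Fin m)) (EuclideanSpace ℝ (Fin n)) π p,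
        V ≠ 0 → (PseudoHyperbolicSpace.metric m s).inner p V V < 0) ∧
    (∀ (b : B) (u v : TangentSpace (𝓡 n) b), LinearIndependent ℝ ![u, v] →
      (SemiRiemannianMetric.ofRiemannian gB).sectionalCurvature b u v < 0) := by
  have hpos : ∀ (z : B) (v : EuclideanSpace ℝ (Fin n)), v ≠ 0 →
      0 < (SemiRiemannianMetric.ofRiemannian gB).inner z v v := fun z v hv => gB.pos z v hv
  -- For `n ≥ 1` the model of the base is nontrivial, so there is a nonzero horizontal vector
  -- against which to test the vertical ones.
  have : Nonempty (Fin n) := ⟨⟨0, hn⟩⟩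
  refine ⟨?_, fun p V hV hV0 => ?_, fun b u v huv => ?_⟩
  · simpa using PseudoHyperbolicSpace.finrank_add_eq hπ hpos hgeo hsm
  · exact (PseudoHyperbolicSpace.metric_inner p V V).trans_lt
      (PseudoHyperbolicSpace.form_emb_neg hπ hpos hgeo p hV hV0)
  · exact PseudoHyperbolicSpace.sectionalCurvature_neg hπ hpos hgeo huv
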